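/- Let $A\in\mathbb R^{n\times n}$, $B\in\mathbb R^{n\times m}$, $C\in\mathbb R^{p\times n}$, and consider $N$ identical systems $$\dot x_k=Ax_k+Bu_k,\qquad y_k=Cx_k,\qquad k=1,\dots,N .$$ Assume that $(A,B)$ is stabilizable, that $(A,C)$ is detectable, and that all eigenvalues of $A$ lie in the closed left half-plane. The communication graph is a time-varying weighted digraph on the nodes $1,\dots,N$ with weights $a_{kj}(t)\in\{0\}\cup[w_{\min},w_{\max}]$ for $t\ge 0$, where $0<w_{\min}\le w_{\max}$, and $a_{kk}(t)=0$. Its Laplacian $L(t)$, with $l_{kk}=\sum_i a_{ki}$ and $l_{kj}=-a_{kj}$ for $j\neq k$, is assumed piecewise continuous and bounded on $[0,\infty)$. The graph is assumed uniformly connected: there are $T>0$, $\delta>0$ and a node $r$ such that for every $t\ge 0$ and every node $j\ne r$ there is a path $j=k_0,k_1,\dots,k_q=r$ with $\int_t^{t+T}a_{k_{i}k_{i+1}}(\tau)\,d\tau\ge\delta$ for $i=0,\dots,q-1$. Let $K\in\mathbb R^{m\times n}$ and $H\in\mathbb R^{n\times p}$ be any matrices such that $A+BK$ and $A+HC$ are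 Hurwitz, and apply the controller $$\dot\eta_k=(A+BK)\eta_k+\sum_{j=1}^N a_{kj}(t)\,(\eta_j-\eta_k+\hat x_k-\hat x_j),$$ $$\dot{\hat x}_k=A\hat x_k+Bu_k+H(\hat y_k-y_k),\qquad u_k=K\eta_k,\qquad \hat y_k=C\hat x_k .$$ Then the closed-loop solutions exponentially synchronize to a solution of $\dot x_0=Ax_0$: there are constants $c,\alpha>0$ such that for every $t_0\ge 0$ and every closed-loop solution $(x,\eta,\hat x)$ on $[t_0,\infty)$ (continuous, and satisfying the differential equations at all $t>t_0$ at which $L$ is continuous) there is a solution $x_0$ of $\dot x_0=Ax_0$ such that, for all $k$ and all $t\ge t_0$, both $\|x_k(t)-x_0(t)\|$ and $\|u_k(t)\|$ are at most $$c\,e^{-\alpha(t-t_0)}\sum_{j=1}^N\bigl(\|x_j(t_0)-x_0(t_0)\|+\|\eta_j(t_0)\|+\|\hat x_j(t_0)-x_0(t_0)\|\bigr).$$ -/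

import Mathlib

open scoped Matrix Topology
open Filter

/-- Every (complex) eigenvalue of the real matrix `M` has negative real part. -/
def IsHurwitz {n : ℕ} (M : Matrix (Fin n) (Fin n) ℝ) : Prop :=
  ∀ μ : ℂ, μ ∈ spectrum ℂ (M.map (algebraMap ℝ ℂ)) → μ.re < 0

/-- Every (complex) eigenvalue of the real matrix `M` lies in the closed left half-plane. -/
def SpectrumInClosedLeftHalfPlane {n : ℕ} (M : Matrix (Fin n) (Fin n) ℝ) : Prop :=
  ∀ μ : ℂ, μ ∈ spectrum ℂ (M.map (algebraMap ℝ ℂ)) → μ.re ≤ 0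

/-- `(A, B)` is stabilizable: some state feedback makes `A + B K` Hurwitz. -/
def IsStabilizable {n m : ℕ} (A : Matrix (Fin n) (Fin n) ℝ) (B : Matrix (Fin n) (Fin m) ℝ) :
    Prop :=
  ∃ K : Matrix (Fin m) (Fin n) ℝ, IsHurwitz (A + B * K)

/-- `(A, C)` is detectable: some output injection makes `A + H C` Hurwitz. -/
def IsDetectable {n p : ℕ} (A : Matrix (Fin n) (Fin n) ℝ) (C : Matrix (Fin p) (Fin n) ℝ) :
    Prop :=
  ∃ H : Matrix (Fin n) (Fin p) ℝ, IsHurwitz (A + H * C)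

/-- A time-varying weighted digraph on the nodes `Fin N` for times `t ≥ 0`: `weight t k j` is
the weight `a_kj(t)` with which node `k` uses the information of node `j`; it is either `0` (no
edge from `k` to `j`) or lies in `[wmin, wmax]`, and there are no self-cycles. -/
structure TimeVaryingDigraph (N : ℕ) where
  weight : ℝ → Matrix (Fin N) (Fin N) ℝ
  wmin : ℝ
  wmax : ℝ
  wmin_pos : 0 < wmin
  wmin_le_wmax : wmin ≤ wmax
  weight_mem : ∀ t : ℝ, 0 ≤ t → ∀ k j, weight t k j = 0 ∨ weight t k j ∈ Set.Icc wmin wmax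
  weight_self : ∀ t : ℝ, 0 ≤ t → ∀ k, weight t k k = 0

namespace TimeVaryingDigraph

variable {N : ℕ}

/-- The Laplacian matrix `L(t)`. -/
def laplacian (G : TimeVaryingDigraph N) (t : ℝ) : Matrix (Fin N) (Fin N) ℝ :=
  Matrix.of fun k j => if j = k then ∑ i, G.weight t k i else - G.weight t k j

/-- The arcs `k → j` of the weighted digraph with adjacency matrix `∫ A_d(τ) dτ` over
`[a, b]`, where an arc counts only if its weight is at least `δ`. For `a ≥ 0` and `δ > 0` these
are arcs of the graph at some time of `[a, b]`. -/
def ArcAcross (G : TimeVaryingDigraph N) (δ a b : ℝ) (k j : Fin N) : Prop :=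
  δ ≤ ∫ τ in a..b, G.weight τ k j

/-- Uniform connectivity: there are a horizon `T > 0`, a threshold `δ > 0` and a node `r` such
that for every `t ≥ 0` each other node `j` is connected to `r` across `[t, t + T]`, i.e. there is
a path `j → ⋯ → r` of arcs of the integrated graph. -/
def UniformlyConnected (G : TimeVaryingDigraph N) : Prop :=
  ∃ T : ℝ, 0 < T ∧ ∃ δ : ℝ, 0 < δ ∧ ∃ r : Fin N, ∀ t : ℝ, 0 ≤ t → ∀ j : Fin N, j ≠ r →
    Relation.TransGen (G.ArcAcross δ t (t + T)) j r

end TimeVaryingDigraph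

/-- Piecewise continuity on `[0, ∞)`: finitely many discontinuities in every bounded interval,
and one-sided limits everywhere. -/
def PiecewiseContinuousOnHalfLine {E : Type*} [TopologicalSpace E] (f : ℝ → E) : Prop :=
  (∀ b : ℝ, {t : ℝ | t ∈ Set.Ioo 0 b ∧ ¬ ContinuousAt f t}.Finite) ∧
  (∀ t : ℝ, 0 ≤ t → ∃ l : E, Tendsto f (𝓝[>] t) (𝓝 l)) ∧
  (∀ t : ℝ, 0 < t → ∃ l : E, Tendsto f (𝓝[<] t) (𝓝 l))

/-- Entrywise boundedness of a matrix-valued function on `[0, ∞)`. -/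
def BoundedOnHalfLine {N : ℕ} (L : ℝ → Matrix (Fin N) (Fin N) ℝ) : Prop :=
  ∃ M : ℝ, ∀ t : ℝ, 0 ≤ t → ∀ k j, |L t k j| ≤ M

/-- The Euclidean norm on `ℝⁿ`. -/
noncomputable def euclNorm {n : ℕ} (v : Fin n → ℝ) : ℝ := ‖WithLp.toLp 2 v‖

/-- `(x, η, x̂)` solves, from time `t₀` on, the closed loop of the `N` systems
`ẋ_k = A x_k + B u_k`, `y_k = C x_k` with the observer-based controller
`η̇_k = (A + B K) η_k + ∑_j a_kj(t) (η_j - η_k + x̂_k - x̂_j)`,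
`x̂̇_k = A x̂_k + B u_k + H (ŷ_k - y_k)`, `u_k = K η_k`, `ŷ_k = C x̂_k`.
The functions are continuous on `[t₀, ∞)` and the differential equations hold at all times
`t > t₀` at which the Laplacian is continuous. -/
structure IsClosedLoopSolution {N n m p : ℕ} (A : Matrix (Fin n) (Fin n) ℝ)
    (B : Matrix (Fin n) (Fin m) ℝ) (C : Matrix (Fin p) (Fin n) ℝ)
    (K : Matrix (Fin m) (Fin n) ℝ) (H : Matrix (Fin n) (Fin p) ℝ)
    (G : TimeVaryingDigraph N) (t₀ : ℝ) (x η xhat : Fin N → ℝ → Fin n → ℝ) : Prop where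
  continuousOn_x : ∀ k, ContinuousOn (x k) (Set.Ici t₀)
  continuousOn_η : ∀ k, ContinuousOn (η k) (Set.Ici t₀)
  continuousOn_xhat : ∀ k, ContinuousOn (xhat k) (Set.Ici t₀)
  deriv_x : ∀ k, ∀ t, t₀ < t → ContinuousAt G.laplacian t →
    HasDerivAt (x k) (A *ᵥ x k t + B *ᵥ (K *ᵥ η k t)) t
  deriv_η : ∀ k, ∀ t, t₀ < t → ContinuousAt G.laplacian t →
    HasDerivAt (η k) ((A + B * K) *ᵥ η k t
      + ∑ j, G.weight t k j • (η j t - η k t + xhat k t - xhat j t)) t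
  deriv_xhat : ∀ k, ∀ t, t₀ < t → ContinuousAt G.laplacian t →
    HasDerivAt (xhat k) (A *ᵥ xhat k t + B *ᵥ (K *ᵥ η k t)
      + H *ᵥ (C *ᵥ xhat k t - C *ᵥ x k t)) t

/-- Exponential synchronization of the closed loop to the open-loop system `ẋ₀ = A x₀`: with
constants `c, α > 0` that serve all initial times `t₀ ≥ 0` and all solutions, each solution has
a solution `x₀` of `ẋ₀ = A x₀` to which all states converge, while the control inputs
`u_k = K η_k` vanish, at the rate `c e^{-α (t - t₀)}` times the initial deviation of the
closed-loop state from the synchronized state `x_k = x̂_k = x₀`, `η_k = 0`. -/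
def ExponentiallySynchronizes {n m p : ℕ} (N : ℕ) (A : Matrix (Fin n) (Fin n) ℝ)
    (B : Matrix (Fin n) (Fin m) ℝ) (C : Matrix (Fin p) (Fin n) ℝ)
    (K : Matrix (Fin m) (Fin n) ℝ) (H : Matrix (Fin n) (Fin p) ℝ)
    (G : TimeVaryingDigraph N) : Prop :=
  ∃ c : ℝ, 0 < c ∧ ∃ α : ℝ, 0 < α ∧
    ∀ t₀ : ℝ, 0 ≤ t₀ → ∀ x η xhat : Fin N → ℝ → Fin n → ℝ,
      IsClosedLoopSolution A B C K H G t₀ x η xhat →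
      ∃ x₀ : ℝ → Fin n → ℝ, (∀ t, HasDerivAt x₀ (A *ᵥ x₀ t) t) ∧
        ∀ k : Fin N, ∀ t : ℝ, t₀ ≤ t →
          euclNorm (x k t - x₀ t) ≤ c * Real.exp (-α * (t - t₀)) *
            ∑ j, (euclNorm (x j t₀ - x₀ t₀) + euclNorm (η j t₀)
              + euclNorm (xhat j t₀ - x₀ t₀)) ∧
          euclNorm (K *ᵥ η k t) ≤ c * Real.exp (-α * (t - t₀)) *
            ∑ j, (euclNorm (x j t₀ - x₀ t₀) + euclNorm (η j t₀)
              + euclNorm (xhat j t₀ - x₀ t₀))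

/-! In the coordinates `s = x̂ - η`, `η`, `e = x̂ - x` the closed loop is a cascade. The observer
error `e` is autonomous with matrix `A + H C`. The variable `s` obeys `ṡ_k = A s_k + ∑_j a_kj (s_j -
s_k) + H C e_k`, and `η` is the stable system `A + B K` driven by the disagreement of `s`. So `e`
decays, and everything rests on exponential decay of `s_j - s_k`. Given that, `η` decays and each
`s_k` solves `ẋ = A x` up to an exponentially small input; since `A` has no unstable eigenvalues, it
converges to a free solution (`exists_asymptotic_solution`). Finally `x = s + η - e`.

For the disagreement, each `s_k` is transported back by the flow of `A`, which removes the drift and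
leaves a perturbed consensus equation. Tested against a functional of norm at most one, this becomes
a scalar positive system: a lower bound at the root spreads along the arcs of the integrated graph
to all nodes within `N` windows, at the cost of a fixed factor (`IsSupersolution.spread`). Applied
to the upper or the lower half of the range of values, this shrinks the diameter by a fixed factor
(`IsPerturbedConsensus.contract`). Undoing the transport costs the norm of the flow, which grows
subexponentially, so a long enough window still halves the disagreement (`exists_halving_window`),
uniformly in the starting time.

The growth of the flow is read off from generalized eigenspaces: a central part with subexponential
growth in both time directions, and a stable part (`exists_central_projection`). -/

/-! ### Monotonicity and mean value inequality with finitely many exceptional times -/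

/-- A continuous function on `[a, b]` with nonnegative derivative off a finite set satisfies
`g a ≤ g b`. -/
theorem le_of_hasDerivAt_nonneg_off_finset (T : Finset ℝ) {g : ℝ → ℝ} :
    ∀ {a b : ℝ}, a ≤ b → ContinuousOn g (Set.Icc a b) →
    (∀ t ∈ Set.Ioo a b, t ∉ T → ∃ d, 0 ≤ d ∧ HasDerivAt g d t) → g a ≤ g b := by
  induction T using Finset.induction_on with
  | empty =>
    intro a b hab hc hd
    have hmono : MonotoneOn g (Set.Icc a b) := by
      refine monotoneOn_of_deriv_nonneg (convex_Icc a b) hc ?_ ?_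
      · intro t ht
        rw [interior_Icc] at ht
        obtain ⟨d, -, h⟩ := hd t ht (by simp)
        exact h.differentiableAt.differentiableWithinAt
      · intro t ht
        rw [interior_Icc] at ht
        obtain ⟨d, h0, h⟩ := hd t ht (by simp)
        rwa [h.deriv]
    exact hmono (Set.left_mem_Icc.2 hab) (Set.right_mem_Icc.2 hab) hab
  | insert s T hs ih =>
    intro a b hab hc hd
    by_cases hsab : s ∈ Set.Ioo a b
    · refine (ih hsab.1.le (hc.mono (Set.Icc_subset_Icc_right hsab.2.le)) ?_).trans
        (ih hsab.2.le (hc.mono (Set.Icc_subset_Icc_left hsab.1.le)) ?_)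
      · intro t ht htT
        refine hd t ⟨ht.1, ht.2.trans hsab.2⟩ ?_
        simp [htT, ht.2.ne]
      · intro t ht htT
        refine hd t ⟨hsab.1.trans ht.1, ht.2⟩ ?_
        simp [htT, ht.1.ne']
    · refine ih hab hc fun t ht htT => hd t ht ?_
      have : t ≠ s := fun h => hsab (h ▸ ht)
      simp [htT, this]

theorem le_of_hasDerivAt_nonneg_off_finite {g : ℝ → ℝ} {a b : ℝ} {S : Set ℝ}
    (hS : (S ∩ Set.Ioo a b).Finite) (hab : a ≤ b) (hc : ContinuousOn g (Set.Icc a b))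
    (hd : ∀ t ∈ Set.Ioo a b, t ∉ S → ∃ d, 0 ≤ d ∧ HasDerivAt g d t) : g a ≤ g b := by
  refine le_of_hasDerivAt_nonneg_off_finset hS.toFinset hab hc fun t ht hT => hd t ht ?_
  intro h
  exact hT (by simpa using ⟨h, ht⟩)

/-- Mean value inequality with an exceptional set. -/
theorem norm_sub_le_of_norm_hasDerivAt_le_off_finite {E : Type*} [NormedAddCommGroup E]
    [NormedSpace ℝ E] {g : ℝ → E} {B : ℝ → ℝ} {a b : ℝ} {S : Set ℝ}
    (hS : (S ∩ Set.Ioo a b).Finite) (hab : a ≤ b) (hc : ContinuousOn g (Set.Icc a b))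
    (hB : ContinuousOn B (Set.Icc a b))
    (hd : ∀ t ∈ Set.Ioo a b, t ∉ S → ∃ d D, HasDerivAt g d t ∧ HasDerivAt B D t ∧ ‖d‖ ≤ D) :
    ‖g b - g a‖ ≤ B b - B a := by
  -- A norming functional reduces the claim to monotonicity of the scalar function `B - φ ∘ g`.
  obtain ⟨φ, hφ, hφv⟩ := exists_dual_vector'' ℝ (g b - g a)
  have key : B a - φ (g a) ≤ B b - φ (g b) := by
    refine le_of_hasDerivAt_nonneg_off_finite (g := fun t => B t - φ (g t)) hS hab
      (hB.sub (φ.continuous.comp_continuousOn hc)) fun t ht htS => ?_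
    obtain ⟨d, D, h1, h2, h3⟩ := hd t ht htS
    refine ⟨D - φ d, ?_, h2.sub (φ.hasFDerivAt.comp_hasDerivAt t h1)⟩
    have : φ d ≤ ‖d‖ := (le_abs_self _).trans (φ.le_of_opNorm_le hφ d |>.trans (by simp))
    linarith
  have : φ (g b) - φ (g a) = ‖g b - g a‖ := by rw [← map_sub, hφv]; rfl
  linarith

/-! ### Positivity for the consensus differential inequality -/

namespace TimeVaryingDigraph

variable {N : ℕ}

/-- The positive times at which the Laplacian is discontinuous. -/
def switchTimes (G : TimeVaryingDigraph N) : Set ℝ :=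
  {t | 0 < t ∧ ¬ ContinuousAt G.laplacian t}

theorem finite_switchTimes {G : TimeVaryingDigraph N}
    (hpc : PiecewiseContinuousOnHalfLine G.laplacian) (a b : ℝ) :
    (G.switchTimes ∩ Set.Ioo a b).Finite :=
  (hpc.1 b).subset fun _ ht => ⟨⟨ht.1.1, ht.2.2⟩, ht.1.2⟩

theorem wmax_pos (G : TimeVaryingDigraph N) : 0 < G.wmax := G.wmin_pos.trans_le G.wmin_le_wmax

theorem weight_nonneg (G : TimeVaryingDigraph N) {t : ℝ} (ht : 0 ≤ t) (k j : Fin N) :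
    0 ≤ G.weight t k j := by
  rcases G.weight_mem t ht k j with h | h
  · exact h.ge
  · exact G.wmin_pos.le.trans h.1

theorem weight_le (G : TimeVaryingDigraph N) {t : ℝ} (ht : 0 ≤ t) (k j : Fin N) :
    G.weight t k j ≤ G.wmax := by
  rcases G.weight_mem t ht k j with h | h
  · exact h.le.trans G.wmax_pos.le
  · exact h.2

theorem continuousAt_weight (G : TimeVaryingDigraph N) {t : ℝ} (ht : 0 < t)
    (hS : t ∉ G.switchTimes) (k j : Fin N) : ContinuousAt (fun t => G.weight t k j) t := by
  have hc : ContinuousAt G.laplacian t := by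
    by_contra h
    exact hS ⟨ht, h⟩
  by_cases hkj : j = k
  · subst hkj
    -- The diagonal weight cannot be read off from the Laplacian, but it vanishes near `t` because
    -- `t > 0`.
    have : (fun t => G.weight t j j) =ᶠ[𝓝 t] fun _ => 0 := by
      filter_upwards [lt_mem_nhds ht] with s hs using G.weight_self s hs.le j
    exact continuousAt_const.congr this.symm
  · have h1 : ContinuousAt (fun t => G.laplacian t k j) t :=
      (continuous_id.matrix_elem k j).continuousAt.comp hc
    have : (fun t => G.weight t k j) = fun t => - G.laplacian t k j := by
      funext s
      simp [laplacian, hkj]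
    rw [this]
    exact h1.neg

/-- A continuous solution of the differential inequality `v̇_k ≥ ∑_j a_kj (v_j - v_k)` on
`[a, b]`. -/
structure IsSupersolution (G : TimeVaryingDigraph N) (a b : ℝ) (v : Fin N → ℝ → ℝ) : Prop where
  continuousOn : ∀ k, ContinuousOn (v k) (Set.Icc a b)
  deriv_ge : ∀ k, ∀ t ∈ Set.Ioo a b, t ∉ G.switchTimes →
    ∃ d, HasDerivAt (v k) d t ∧ ∑ j, G.weight t k j * (v j t - v k t) ≤ d

theorem IsSupersolution.mono {G : TimeVaryingDigraph N} {a b a' b' : ℝ} {v : Fin N → ℝ → ℝ}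
    (h : G.IsSupersolution a b v) (ha : a ≤ a') (hb : b' ≤ b) : G.IsSupersolution a' b' v :=
  ⟨fun k => (h.continuousOn k).mono (Set.Icc_subset_Icc ha hb),
    fun k t ht => h.deriv_ge k t ⟨ha.trans_lt ht.1, ht.2.trans_le hb⟩⟩

/-- The rate `N w_max`, which bounds all row sums of the weights. -/
def rate (G : TimeVaryingDigraph N) : ℝ := N * G.wmax

theorem rate_nonneg (G : TimeVaryingDigraph N) : 0 ≤ G.rate :=
  mul_nonneg (Nat.cast_nonneg _) G.wmax_pos.le

/-- The integrating factor `e^{rate (t - a)}` adds `w_max` to the coefficient of `v_k` once for each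
`j`. This compensates every `-a_kj`, so the right-hand side becomes a combination of the scaled
values with nonnegative coefficients of total `rate`. -/
theorem IsSupersolution.scaled_deriv {G : TimeVaryingDigraph N} {a b : ℝ} {v : Fin N → ℝ → ℝ}
    (h : G.IsSupersolution a b v) (k : Fin N) {t : ℝ} (ht : t ∈ Set.Ioo a b)
    (hS : t ∉ G.switchTimes) :
    ∃ d, HasDerivAt (fun t => Real.exp (G.rate * (t - a)) * v k t) d t ∧
      ∑ j, (G.weight t k j * (Real.exp (G.rate * (t - a)) * v j t)
        + (G.wmax - G.weight t k j) * (Real.exp (G.rate * (t - a)) * v k t)) ≤ d := by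
  obtain ⟨d, h1, h2⟩ := h.deriv_ge k t ht hS
  have he : HasDerivAt (fun t => Real.exp (G.rate * (t - a)))
      (Real.exp (G.rate * (t - a)) * (G.rate * 1)) t :=
    (((hasDerivAt_id t).sub_const a).const_mul G.rate).exp
  refine ⟨_, he.mul h1, ?_⟩
  have hpos := Real.exp_pos (G.rate * (t - a))
  have h3 := mul_le_mul_of_nonneg_left h2 hpos.le
  have h4 : ∑ j, (G.weight t k j * (Real.exp (G.rate * (t - a)) * v j t)
        + (G.wmax - G.weight t k j) * (Real.exp (G.rate * (t - a)) * v k t))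
      = Real.exp (G.rate * (t - a)) * ∑ j, G.weight t k j * (v j t - v k t)
        + Real.exp (G.rate * (t - a)) * (G.rate * 1) * v k t := by
    have : G.rate = ∑ _j : Fin N, G.wmax := by simp [rate]
    generalize Real.exp (G.rate * (t - a)) = e
    rw [this, mul_one, Finset.mul_sum, Finset.mul_sum, Finset.sum_mul, ← Finset.sum_add_distrib]
    exact Finset.sum_congr rfl fun j _ => by ring
  rw [h4]
  linarith

/-- The positive orthant is invariant. -/
theorem IsSupersolution.nonneg {G : TimeVaryingDigraph N}
    (hpc : PiecewiseContinuousOnHalfLine G.laplacian) {a b : ℝ} (ha : 0 ≤ a)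
    {v : Fin N → ℝ → ℝ} (h : G.IsSupersolution a b v) (h0 : ∀ k, 0 ≤ v k a) (k : Fin N) {t : ℝ}
    (ht : t ∈ Set.Icc a b) : 0 ≤ v k t := by
  set u : Fin N → ℝ → ℝ := fun k t => Real.exp (G.rate * (t - a)) * v k t with hu
  have hucont : ∀ k, ContinuousOn (u k) (Set.Icc a b) := fun k =>
    ContinuousOn.mul (by fun_prop) (h.continuousOn k)
  obtain ⟨c, hc0, hc⟩ : ∃ c : ℝ, 0 ≤ c ∧ ∀ k, ∀ t ∈ Set.Icc a b, -c ≤ u k t := by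
    have : ∀ k, ∃ C : ℝ, ∀ t ∈ Set.Icc a b, ‖u k t‖ ≤ C := fun k =>
      isCompact_Icc.exists_bound_of_continuousOn (hucont k)
    choose C hC using this
    refine ⟨∑ k, |C k|, Finset.sum_nonneg fun _ _ => abs_nonneg _, fun k t ht => ?_⟩
    have h1 := (abs_le.1 (hC k t ht)).1
    have h2 : |C k| ≤ ∑ k, |C k| :=
      Finset.single_le_sum (f := fun k => |C k|) (fun _ _ => abs_nonneg _) (Finset.mem_univ k)
    linarith [le_abs_self (C k)]
  -- Picard iteration for lower bounds: the bound of order `n` is inserted into the right-hand side,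
  -- whose coefficients are nonnegative with sum `rate`, and integrated to give order `n + 1`. As `n
  -- → ∞` the bounds tend to `0`.
  have key : ∀ n : ℕ, ∀ k, ∀ t ∈ Set.Icc a b,
      - (c * ((G.rate * (t - a)) ^ n / n.factorial)) ≤ u k t := by
    intro n
    induction n with
    | zero => intro k t ht; simpa using hc k t ht
    | succ n ih =>
      intro k t ht
      have hmono := le_of_hasDerivAt_nonneg_off_finite
        (g := fun t => u k t + c * ((G.rate * (t - a)) ^ (n + 1) / (n + 1).factorial))
        (finite_switchTimes hpc a t) ht.1
        (((hucont k).mono (Set.Icc_subset_Icc_right ht.2)).add (by fun_prop))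
        (fun s hs hsS => by
          have hs' : s ∈ Set.Ioo a b := ⟨hs.1, hs.2.trans_le ht.2⟩
          have hs0 : 0 ≤ s := ha.trans hs.1.le
          obtain ⟨d, h1, h2⟩ := h.scaled_deriv k hs' hsS
          have hp : HasDerivAt (fun t => c * ((G.rate * (t - a)) ^ (n + 1) / (n + 1).factorial))
              (c * (((n + 1 : ℕ) * (G.rate * (s - a)) ^ n * (G.rate * 1))
                / (n + 1).factorial)) s :=
            (((((hasDerivAt_id s).sub_const a).const_mul G.rate).pow (n + 1)).div_const _).const_mul
              c
          refine ⟨_, ?_, h1.add hp⟩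
          set q := c * ((G.rate * (s - a)) ^ n / n.factorial) with hq
          have h3 : c * (((n + 1 : ℕ) * (G.rate * (s - a)) ^ n * (G.rate * 1))
                / (n + 1).factorial) = G.rate * q := by
            rw [hq, Nat.factorial_succ]
            have : (n.factorial : ℝ) ≠ 0 := by positivity
            push_cast
            field_simp
          have h4 : - (G.rate * q) ≤ ∑ j, (G.weight s k j * u j s
              + (G.wmax - G.weight s k j) * u k s) := by
            have : - (G.rate * q) = ∑ _j : Fin N, - (G.wmax * q) := by
              simp [rate, mul_assoc]
            rw [this]
            refine Finset.sum_le_sum fun j _ => ?_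
            have e1 := mul_le_mul_of_nonneg_left (ih j s ⟨hs.1.le, hs'.2.le⟩)
              (G.weight_nonneg hs0 k j)
            have e2 := mul_le_mul_of_nonneg_left (ih k s ⟨hs.1.le, hs'.2.le⟩)
              (sub_nonneg.2 (G.weight_le hs0 k j))
            rw [← hq] at e1 e2
            linarith
          rw [h3]
          linarith)
      have hua : 0 ≤ u k a := by simpa [hu] using h0 k
      simp only [sub_self, mul_zero, ne_eq, Nat.succ_ne_zero, not_false_eq_true, zero_pow,
        zero_div, add_zero] at hmono
      linarith
  have hlim : Tendsto (fun n : ℕ => - (c * ((G.rate * (t - a)) ^ n / n.factorial))) atTop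
      (𝓝 (-(c * 0))) :=
    ((FloorSemiring.tendsto_pow_div_factorial_atTop (G.rate * (t - a))).const_mul c).neg
  have hu0 : -(c * 0) ≤ u k t := le_of_tendsto' hlim fun n => key n k t ht
  simp only [mul_zero, neg_zero] at hu0
  exact nonneg_of_mul_nonneg_right hu0 (Real.exp_pos _)

theorem intervalIntegrable_weight {G : TimeVaryingDigraph N}
    (hpc : PiecewiseContinuousOnHalfLine G.laplacian) {a b : ℝ} (ha : 0 ≤ a) (hab : a ≤ b)
    (k j : Fin N) : IntervalIntegrable (fun t => G.weight t k j) MeasureTheory.volume a b := by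
  have hfin := finite_switchTimes hpc a b
  set U : Set ℝ := Set.Ioo a b \ (G.switchTimes ∩ Set.Ioo a b) with hU
  have hUm : MeasurableSet U := measurableSet_Ioo.diff hfin.measurableSet
  have hcont : ContinuousOn (fun t => G.weight t k j) U := fun t ht =>
    (G.continuousAt_weight (ha.trans_lt ht.1.1) (fun h => ht.2 ⟨h, ht.1⟩) k j).continuousWithinAt
  have hae : U =ᵐ[MeasureTheory.volume] Set.Ioo a b :=
    MeasureTheory.sdiff_null_ae_eq_self (hfin.measure_zero _)
  rw [intervalIntegrable_iff_integrableOn_Ioo_of_le hab]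
  have : MeasureTheory.IntegrableOn (fun t => G.weight t k j) U := by
    refine MeasureTheory.IntegrableOn.of_bound (C := G.wmax) ?_
      (hcont.aestronglyMeasurable hUm) ?_
    · exact ((MeasureTheory.measure_mono Set.sdiff_subset).trans_lt (by simp))
    · filter_upwards [MeasureTheory.ae_restrict_mem hUm] with t ht
      have ht0 := ha.trans ht.1.1.le
      rw [Real.norm_of_nonneg (G.weight_nonneg ht0 k j)]
      exact G.weight_le ht0 k j
  exact this.congr_set_ae hae.symm

/-- A lower bound of `v_j` on `[a, b]` is passed on to `v_k` in proportion to the integral of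
the weight `a_kj`. -/
theorem IsSupersolution.arc_gain {G : TimeVaryingDigraph N}
    (hpc : PiecewiseContinuousOnHalfLine G.laplacian) {a b : ℝ} (ha : 0 ≤ a) (hab : a ≤ b)
    {v : Fin N → ℝ → ℝ} (h : G.IsSupersolution a b v) (h0 : ∀ k, 0 ≤ v k a) (k j : Fin N) {β : ℝ}
    (hβ : 0 ≤ β) (hj : ∀ t ∈ Set.Icc a b, β ≤ v j t) :
    v k a + β * ∫ τ in a..b, G.weight τ k j ≤ Real.exp (G.rate * (b - a)) * v k b := by
  have hint := intervalIntegrable_weight hpc ha hab k j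
  have hmono := le_of_hasDerivAt_nonneg_off_finite
    (g := fun t => Real.exp (G.rate * (t - a)) * v k t - β * ∫ τ in a..t, G.weight τ k j)
    (finite_switchTimes hpc a b) hab
    ((ContinuousOn.mul (by fun_prop) (h.continuousOn k)).sub
      (continuousOn_const.mul (by
        have := intervalIntegral.continuousOn_primitive_interval (a := a) (b := b)
          (f := fun τ => G.weight τ k j) (μ := MeasureTheory.volume)
          (by rw [Set.uIcc_of_le hab]
              exact (intervalIntegrable_iff_integrableOn_Icc_of_le hab).1 hint)
        rwa [Set.uIcc_of_le hab] at this)))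
    (fun s hs hsS => by
      have hs0 : 0 ≤ s := ha.trans hs.1.le
      obtain ⟨d, h1, h2⟩ := h.scaled_deriv k hs hsS
      have hcs := G.continuousAt_weight (ha.trans_lt hs.1) hsS k j
      have hfin := finite_switchTimes hpc a b
      have hopen : IsOpen (Set.Ioo a b \ (G.switchTimes ∩ Set.Ioo a b)) :=
        isOpen_Ioo.sdiff hfin.isClosed
      have hmeas : StronglyMeasurableAtFilter (fun τ => G.weight τ k j) (𝓝 s)
          MeasureTheory.volume :=
        ContinuousOn.stronglyMeasurableAtFilter hopen (fun t ht =>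
          (G.continuousAt_weight (ha.trans_lt ht.1.1)
            (fun h => ht.2 ⟨h, ht.1⟩) k j).continuousWithinAt) s ⟨hs, fun h => hsS h.1⟩
      have hI : HasDerivAt (fun t => ∫ τ in a..t, G.weight τ k j) (G.weight s k j) s :=
        intervalIntegral.integral_hasDerivAt_right
          (hint.mono_set (by
            rw [Set.uIcc_of_le hs.1.le, Set.uIcc_of_le hab]
            exact Set.Icc_subset_Icc_right hs.2.le)) hmeas hcs
      refine ⟨_, ?_, h1.sub (hI.const_mul β)⟩
      have hv : ∀ i, 0 ≤ v i s := fun i => h.nonneg hpc ha h0 i ⟨hs.1.le, hs.2.le⟩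
      have hexp : 1 ≤ Real.exp (G.rate * (s - a)) :=
        Real.one_le_exp (mul_nonneg G.rate_nonneg (sub_nonneg.2 hs.1.le))
      have hterm : ∀ i, 0 ≤ G.weight s k i * (Real.exp (G.rate * (s - a)) * v i s)
          + (G.wmax - G.weight s k i) * (Real.exp (G.rate * (s - a)) * v k s) := fun i =>
        add_nonneg (mul_nonneg (G.weight_nonneg hs0 k i) (mul_nonneg (by positivity) (hv i)))
          (mul_nonneg (sub_nonneg.2 (G.weight_le hs0 k i)) (mul_nonneg (by positivity) (hv k)))
      -- Only the summand of `j` is kept; there the exponential is at least `1` and `v_j ≥ β`, so it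
      -- dominates the derivative `β a_kj` of the subtracted integral.
      have hsingle := Finset.single_le_sum (fun i _ => hterm i) (Finset.mem_univ j)
      have e1 : 0 ≤ (G.wmax - G.weight s k j) * (Real.exp (G.rate * (s - a)) * v k s) :=
        mul_nonneg (sub_nonneg.2 (G.weight_le hs0 k j)) (mul_nonneg (by positivity) (hv k))
      have e2 : G.weight s k j * β ≤ G.weight s k j * (Real.exp (G.rate * (s - a)) * v j s) := by
        refine mul_le_mul_of_nonneg_left ?_ (G.weight_nonneg hs0 k j)
        have := hj s ⟨hs.1.le, hs.2.le⟩
        nlinarith [hv j]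
      linarith)
  simp only [sub_self, mul_zero, Real.exp_zero, one_mul, intervalIntegral.integral_same,
    sub_zero] at hmono
  linarith

/-- Persistence of a positive lower bound. -/
theorem IsSupersolution.persist {G : TimeVaryingDigraph N}
    (hpc : PiecewiseContinuousOnHalfLine G.laplacian) {a b : ℝ} (ha : 0 ≤ a) (hab : a ≤ b)
    {v : Fin N → ℝ → ℝ} (h : G.IsSupersolution a b v) (h0 : ∀ k, 0 ≤ v k a) (k : Fin N) :
    Real.exp (-(G.rate * (b - a))) * v k a ≤ v k b := by
  -- The case `β = 0`, where the choice of arc is immaterial.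
  have h1 := h.arc_gain hpc ha hab h0 k k le_rfl
    (fun t ht => h.nonneg hpc ha h0 k ht)
  rw [zero_mul, add_zero] at h1
  calc _ ≤ Real.exp (-(G.rate * (b - a))) * (Real.exp (G.rate * (b - a)) * v k b) :=
        mul_le_mul_of_nonneg_left h1 (Real.exp_pos _).le
    _ = v k b := by rw [← mul_assoc, ← Real.exp_add]; simp

end TimeVaryingDigraph

/-- A path that starts outside `S` and ends in `S` must enter `S` along some arc. This finds the
node to which a lower bound spreads next. -/
theorem exists_rel_of_transGen_of_notMem {α : Type*} {R : α → α → Prop} {S : Set α} {k r : α}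
    (h : Relation.TransGen R k r) (hk : k ∉ S) (hr : r ∈ S) : ∃ i ∉ S, ∃ j ∈ S, R i j := by
  induction h with
  | single h => exact ⟨_, hk, _, hr, h⟩
  | @tail b c _ h2 ih =>
    by_cases hb : b ∈ S
    · exact ih hb
    · exact ⟨b, hb, c, hr, h2⟩

/-! ### Spreading of a lower bound from the root -/

namespace TimeVaryingDigraph

variable {N : ℕ}

/-- The fraction of a lower bound that survives a window of length `T` and one arc of integrated
weight `δ`. -/
noncomputable def gain (G : TimeVaryingDigraph N) (T δ : ℝ) : ℝ :=
  Real.exp (-(G.rate * T)) * min 1 (Real.exp (-(G.rate * T)) * δ)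

theorem gain_pos (G : TimeVaryingDigraph N) (T : ℝ) {δ : ℝ} (hδ : 0 < δ) : 0 < G.gain T δ :=
  mul_pos (Real.exp_pos _) (lt_min one_pos (mul_pos (Real.exp_pos _) hδ))

theorem gain_le_one (G : TimeVaryingDigraph N) {T δ : ℝ} (hT : 0 ≤ T) (hδ : 0 < δ) :
    G.gain T δ ≤ 1 :=
  mul_le_one₀ (Real.exp_le_one_iff.2 (neg_nonpos.2 (mul_nonneg G.rate_nonneg hT)))
    (lt_min one_pos (mul_pos (Real.exp_pos _) hδ)).le (min_le_left _ _)

/-- Bounds on `S` persist through the window up to the factor `e^{-rate T}`. If `S` is not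
everything, the integrated graph has an arc from outside into `S`, and by `arc_gain` its tail
inherits a bound at the end of the window. The factor `gain` lies below both surviving fractions,
that of the old nodes and that of the new one. -/
theorem IsSupersolution.spread_step {G : TimeVaryingDigraph N}
    (hpc : PiecewiseContinuousOnHalfLine G.laplacian) {a T δ : ℝ} (ha : 0 ≤ a) (hT : 0 ≤ T)
    {r : Fin N}
    (hpath : ∀ j, j ≠ r → Relation.TransGen (G.ArcAcross δ a (a + T)) j r)
    {v : Fin N → ℝ → ℝ} (h : G.IsSupersolution a (a + T) v) (h0 : ∀ k, 0 ≤ v k a) {β : ℝ}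
    (hβ : 0 ≤ β) {S : Finset (Fin N)} (hr : r ∈ S) (hS : ∀ k ∈ S, β ≤ v k a) :
    ∃ S' : Finset (Fin N), r ∈ S' ∧ (S' = Finset.univ ∨ S.card + 1 ≤ S'.card) ∧
      ∀ k ∈ S', G.gain T δ * β ≤ v k (a + T) := by
  have haT : a ≤ a + T := by linarith
  set E := Real.exp (-(G.rate * T)) with hE
  have hEpos : 0 < E := Real.exp_pos _
  have hpersist : ∀ t ∈ Set.Icc a (a + T), ∀ k ∈ S, E * β ≤ v k t := by
    intro t ht k hk
    have h1 := (h.mono le_rfl ht.2).persist hpc ha ht.1 h0 k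
    refine le_trans (mul_le_mul ?_ (hS k hk) hβ (Real.exp_pos _).le) h1
    refine Real.exp_le_exp.2 (neg_le_neg (mul_le_mul_of_nonneg_left ?_ G.rate_nonneg))
    linarith [ht.2]
  have hold : ∀ k ∈ S, G.gain T δ * β ≤ v k (a + T) := by
    intro k hk
    refine le_trans ?_ (hpersist (a + T) ⟨haT, le_rfl⟩ k hk)
    exact mul_le_mul_of_nonneg_right (mul_le_of_le_one_right hEpos.le (min_le_left _ _)) hβ
  by_cases hu : S = Finset.univ
  · exact ⟨S, hr, Or.inl hu, hold⟩
  · obtain ⟨k₀, hk₀⟩ : ∃ k, k ∉ S := by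
      by_contra hcon
      push Not at hcon
      exact hu (Finset.eq_univ_iff_forall.2 hcon)
    obtain ⟨k, hk, j, hj, hkj⟩ := exists_rel_of_transGen_of_notMem (S := (S : Set (Fin N)))
      (hpath k₀ fun hh => hk₀ (hh ▸ hr)) (by simpa using hk₀) (by simpa using hr)
    refine ⟨insert k S, Finset.mem_insert_of_mem hr,
      Or.inr (Finset.card_insert_of_notMem (by simpa using hk)).ge, fun i hi => ?_⟩
    rcases Finset.mem_insert.1 hi with rfl | hi
    · have h1 := h.arc_gain hpc ha haT h0 i j (mul_nonneg hEpos.le hβ)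
        (fun t ht => hpersist t ht j (by simpa using hj))
      have h2 : E * β * δ ≤ E * β * ∫ τ in a..a + T, G.weight τ i j :=
        mul_le_mul_of_nonneg_left hkj (mul_nonneg hEpos.le hβ)
      have h3 : E * β * δ ≤ Real.exp (G.rate * T) * v i (a + T) := by
        rw [add_sub_cancel_left] at h1
        linarith [h0 i]
      calc G.gain T δ * β ≤ E * (E * δ) * β :=
            mul_le_mul_of_nonneg_right (mul_le_mul_of_nonneg_left (min_le_right _ _) hEpos.le) hβ
        _ = E * (E * β * δ) := by ring
        _ ≤ E * (Real.exp (G.rate * T) * v i (a + T)) := mul_le_mul_of_nonneg_left h3 hEpos.le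
        _ = v i (a + T) := by rw [hE, ← mul_assoc, ← Real.exp_add]; simp
    · exact hold i hi

/-- Uniform connectivity with given horizon, threshold and root. -/
def ConnectedWith (G : TimeVaryingDigraph N) (T δ : ℝ) (r : Fin N) : Prop :=
  0 < T ∧ 0 < δ ∧ ∀ t : ℝ, 0 ≤ t → ∀ j : Fin N, j ≠ r →
    Relation.TransGen (G.ArcAcross δ t (t + T)) j r

/-- A lower bound at the root is passed on to all nodes within `N` windows. -/
theorem IsSupersolution.spread {G : TimeVaryingDigraph N}
    (hpc : PiecewiseContinuousOnHalfLine G.laplacian) {T δ : ℝ} {r : Fin N}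
    (hG : G.ConnectedWith T δ r) {a : ℝ} (ha : 0 ≤ a) {v : Fin N → ℝ → ℝ}
    (h : G.IsSupersolution a (a + N * T) v) (h0 : ∀ k, 0 ≤ v k a) {β : ℝ} (hβ : 0 ≤ β)
    (hr : β ≤ v r a) (k : Fin N) : G.gain T δ ^ N * β ≤ v k (a + N * T) := by
  obtain ⟨hT, hδ, hpath⟩ := hG
  -- Each window adds a node until all are reached. At `i = N` the alternative would require `N + 1`
  -- nodes; `N - 1` windows would suffice, but `N` avoids the subtraction.
  have key : ∀ i : ℕ, i ≤ N → ∃ S : Finset (Fin N), r ∈ S ∧ (S = Finset.univ ∨ i + 1 ≤ S.card) ∧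
      ∀ k ∈ S, G.gain T δ ^ i * β ≤ v k (a + i * T) := by
    intro i
    induction i with
    | zero =>
      intro _
      refine ⟨{r}, by simp, Or.inr (by simp), fun k hk => ?_⟩
      rw [Finset.mem_singleton.1 hk]
      simpa using hr
    | succ i ih =>
      intro hi
      obtain ⟨S, hrS, hcard, hS⟩ := ih (by omega)
      have hiT : 0 ≤ i * T := by positivity
      have hend : a + i * T + T = a + (i + 1 : ℕ) * T := by push_cast; ring
      have hle : a + (i + 1 : ℕ) * T ≤ a + N * T := by
        have : ((i + 1 : ℕ) : ℝ) ≤ N := by exact_mod_cast hi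
        nlinarith
      obtain ⟨S', hrS', hcard', hS'⟩ := (h.mono (a' := a + i * T) (b' := a + i * T + T)
        (by linarith) (hend.trans_le hle)).spread_step hpc (by linarith) hT.le
        (hpath _ (by linarith))
        (fun k => h.nonneg hpc ha h0 k ⟨by linarith, by linarith⟩)
        (mul_nonneg (pow_nonneg (G.gain_pos T hδ).le i) hβ) hrS hS
      refine ⟨S', hrS', ?_, fun k hk => ?_⟩
      · rcases hcard with rfl | hcard
        · rcases hcard' with h | h
          · exact Or.inl h
          · have := Finset.card_le_univ S'
            rw [Finset.card_univ] at h
            omega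
        · rcases hcard' with h | h
          · exact Or.inl h
          · exact Or.inr (by omega)
      · have := hS' k hk
        rw [hend] at this
        rwa [pow_succ', mul_assoc]
  obtain ⟨S, -, hcard, hS⟩ := key N le_rfl
  rcases hcard with rfl | hcard
  · exact hS k (Finset.mem_univ k)
  · have := Finset.card_le_univ S
    rw [Fintype.card_fin] at this
    omega

/-! ### Contraction of the perturbed consensus dynamics -/

variable {E : Type*} [NormedAddCommGroup E] [NormedSpace ℝ E]

/-- Solutions on `[a, b]` of the consensus dynamics with a perturbation of norm at most `F`. -/
structure IsPerturbedConsensus (G : TimeVaryingDigraph N) (F a b : ℝ) (z : Fin N → ℝ → E) :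
    Prop where
  continuousOn : ∀ k, ContinuousOn (z k) (Set.Icc a b)
  hasDerivAt : ∀ k, ∀ t ∈ Set.Ioo a b, t ∉ G.switchTimes →
    ∃ f : E, ‖f‖ ≤ F ∧ HasDerivAt (z k) (∑ j, G.weight t k j • (z j t - z k t) + f) t

theorem IsPerturbedConsensus.mono {G : TimeVaryingDigraph N} {F a b a' b' : ℝ}
    {z : Fin N → ℝ → E} (h : G.IsPerturbedConsensus F a b z) (ha : a ≤ a') (hb : b' ≤ b) :
    G.IsPerturbedConsensus F a' b' z :=
  ⟨fun k => (h.continuousOn k).mono (Set.Icc_subset_Icc ha hb),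
    fun k t ht => h.hasDerivAt k t ⟨ha.trans_lt ht.1, ht.2.trans_le hb⟩⟩

/-- The coupling acts by real scalars and so commutes with functionals. Hence diameter estimates in
`E` reduce to scalar ones, with a functional norming the difference at the final time. -/
theorem IsPerturbedConsensus.comp_dual {G : TimeVaryingDigraph N} {F a b : ℝ}
    {z : Fin N → ℝ → E} (h : G.IsPerturbedConsensus F a b z) (φ : StrongDual ℝ E)
    (hφ : ‖φ‖ ≤ 1) : G.IsPerturbedConsensus F a b (fun k t => φ (z k t)) := by
  refine ⟨fun k => φ.continuous.comp_continuousOn (h.continuousOn k), fun k t ht htS => ?_⟩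
  obtain ⟨f, hf, hd⟩ := h.hasDerivAt k t ht htS
  refine ⟨φ f, (φ.le_of_opNorm_le hφ f).trans (by simpa using hf), ?_⟩
  refine (φ.hasFDerivAt.comp_hasDerivAt t hd).congr_deriv ?_
  simp [map_sum]

theorem IsPerturbedConsensus.neg {G : TimeVaryingDigraph N} {F a b : ℝ}
    {z : Fin N → ℝ → E} (h : G.IsPerturbedConsensus F a b z) :
    G.IsPerturbedConsensus F a b (fun k t => - z k t) := by
  refine ⟨fun k => (h.continuousOn k).neg, fun k t ht htS => ?_⟩
  obtain ⟨f, hf, hd⟩ := h.hasDerivAt k t ht htS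
  refine ⟨-f, by simpa using hf, ?_⟩
  refine hd.neg.congr_deriv ?_
  rw [neg_add, ← Finset.sum_neg_distrib]
  congr 1
  exact Finset.sum_congr rfl fun j _ => by rw [← smul_neg]; congr 1; abel

/-- The ramp `F (t - a)` raises every derivative by `F`, which outweighs the perturbation, and a
shift common to all nodes leaves the differences in the coupling unchanged. -/
theorem IsPerturbedConsensus.isSupersolution {G : TimeVaryingDigraph N} {F a b : ℝ}
    {z : Fin N → ℝ → ℝ} (h : G.IsPerturbedConsensus F a b z) (m : ℝ) :
    G.IsSupersolution a b (fun k t => z k t - m + F * (t - a)) := by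
  refine ⟨fun k => ((h.continuousOn k).sub continuousOn_const).add (by fun_prop),
    fun k t ht htS => ?_⟩
  obtain ⟨f, hf, hd⟩ := h.hasDerivAt k t ht htS
  refine ⟨_, (hd.sub_const m).add (((hasDerivAt_id t).sub_const a).const_mul F), ?_⟩
  have := (abs_le.1 hf).1
  simp only [smul_eq_mul, mul_one, add_sub_add_right_eq_sub, sub_sub_sub_cancel_right]
  linarith

theorem IsPerturbedConsensus.lower {G : TimeVaryingDigraph N}
    (hpc : PiecewiseContinuousOnHalfLine G.laplacian) {F a b : ℝ} (ha : 0 ≤ a) (hab : a ≤ b)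
    {z : Fin N → ℝ → ℝ} (h : G.IsPerturbedConsensus F a b z) {m : ℝ} (hm : ∀ k, m ≤ z k a)
    (k : Fin N) : m - F * (b - a) ≤ z k b := by
  have := (h.isSupersolution m).nonneg hpc ha (fun k => by simpa using hm k) k
    (Set.right_mem_Icc.2 hab)
  linarith

/-- The spread of the values does not grow, up to the perturbation. -/
theorem IsPerturbedConsensus.norm_sub_le {G : TimeVaryingDigraph N}
    (hpc : PiecewiseContinuousOnHalfLine G.laplacian) {F a b : ℝ} (ha : 0 ≤ a) (hab : a ≤ b)
    {z : Fin N → ℝ → E} (h : G.IsPerturbedConsensus F a b z) {D : ℝ}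
    (hD : ∀ j k, ‖z j a - z k a‖ ≤ D) (j k : Fin N) :
    ‖z j b - z k b‖ ≤ D + 2 * F * (b - a) := by
  obtain ⟨φ, hφ, hφv⟩ := exists_dual_vector'' ℝ (z j b - z k b)
  have hφv' : φ (z j b) - φ (z k b) = ‖z j b - z k b‖ := by rw [← map_sub, hφv]; rfl
  have hy := h.comp_dual φ hφ
  obtain ⟨i, -, hi⟩ := Finset.exists_min_image Finset.univ (fun k => φ (z k a)) ⟨j, by simp⟩
  obtain ⟨l, -, hl⟩ := Finset.exists_max_image Finset.univ (fun k => φ (z k a)) ⟨j, by simp⟩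
  have h1 := hy.lower hpc ha hab (m := φ (z i a)) (fun k => hi k (by simp)) k
  have h2 := hy.neg.lower hpc ha hab (m := - φ (z l a))
    (fun k => neg_le_neg (hl k (by simp))) j
  have h3 : φ (z l a) - φ (z i a) ≤ D := by
    rw [← map_sub]
    exact ((le_abs_self _).trans ((φ.le_of_opNorm_le hφ _).trans (by simp))).trans (hD l i)
  linarith

/-- If the root lies in the upper half of `[m, M]`, its height `(M - m) / 2` above the minimum
spreads to all nodes and lifts the minimum, while the maximum rises only through the perturbation.
-/
theorem IsPerturbedConsensus.contract_aux {G : TimeVaryingDigraph N}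
    (hpc : PiecewiseContinuousOnHalfLine G.laplacian) {T δ : ℝ} {r : Fin N}
    (hG : G.ConnectedWith T δ r) {F a : ℝ} (ha : 0 ≤ a) {z : Fin N → ℝ → ℝ}
    (h : G.IsPerturbedConsensus F a (a + N * T) z) {m M : ℝ} (hm : ∀ k, m ≤ z k a)
    (hM : ∀ k, z k a ≤ M) (hr : (m + M) / 2 ≤ z r a) (j k : Fin N) :
    z j (a + N * T) - z k (a + N * T) ≤
      (1 - G.gain T δ ^ N / 2) * (M - m) + 2 * F * (N * T) := by
  have hNT : 0 ≤ N * T := mul_nonneg (Nat.cast_nonneg _) hG.1.le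
  have h1 := (h.isSupersolution m).spread hpc hG ha (fun k => by simpa using hm k)
    (β := (M - m) / 2) (by linarith [hm r, hM r]) (by simp only [sub_self, mul_zero]; linarith) k
  have h2 := h.neg.lower hpc ha (by linarith) (m := -M) (fun k => neg_le_neg (hM k)) j
  rw [add_sub_cancel_left] at h1 h2
  linarith

/-- Over `N` windows the spread of the values contracts, up to the perturbation. -/
theorem IsPerturbedConsensus.contract {G : TimeVaryingDigraph N}
    (hpc : PiecewiseContinuousOnHalfLine G.laplacian) {T δ : ℝ} {r : Fin N}
    (hG : G.ConnectedWith T δ r) {F a : ℝ} (ha : 0 ≤ a) {z : Fin N → ℝ → E}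
    (h : G.IsPerturbedConsensus F a (a + N * T) z) {D : ℝ}
    (hD : ∀ j k, ‖z j a - z k a‖ ≤ D) (j k : Fin N) :
    ‖z j (a + N * T) - z k (a + N * T)‖ ≤
      (1 - G.gain T δ ^ N / 2) * D + 2 * F * (N * T) := by
  set b := a + N * T with hb
  obtain ⟨φ, hφ, hφv⟩ := exists_dual_vector'' ℝ (z j b - z k b)
  have hφv' : φ (z j b) - φ (z k b) = ‖z j b - z k b‖ := by rw [← map_sub, hφv]; rfl
  have hy := h.comp_dual φ hφ
  obtain ⟨i, -, hi⟩ := Finset.exists_min_image Finset.univ (fun k => φ (z k a)) ⟨j, by simp⟩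
  obtain ⟨l, -, hl⟩ := Finset.exists_max_image Finset.univ (fun k => φ (z k a)) ⟨j, by simp⟩
  have h3 : φ (z l a) - φ (z i a) ≤ D := by
    rw [← map_sub]
    exact ((le_abs_self _).trans ((φ.le_of_opNorm_le hφ _).trans (by simp))).trans (hD l i)
  have hgain : G.gain T δ ^ N ≤ 1 :=
    pow_le_one₀ (G.gain_pos T hG.2.1).le (G.gain_le_one hG.1.le hG.2.1)
  have h4 : (1 - G.gain T δ ^ N / 2) * (φ (z l a) - φ (z i a)) ≤ (1 - G.gain T δ ^ N / 2) * D :=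
    mul_le_mul_of_nonneg_left h3 (by linarith)
  -- If the root lies in the lower half, the same argument applies to `-z`, with `j` and `k`
  -- exchanged.
  rcases le_total ((φ (z i a) + φ (z l a)) / 2) (φ (z r a)) with hr | hr
  · have := hy.contract_aux hpc hG ha (fun k => hi k (by simp)) (fun k => hl k (by simp)) hr j k
    linarith
  · have := hy.neg.contract_aux hpc hG ha (fun k => neg_le_neg (hl k (by simp)))
      (fun k => neg_le_neg (hi k (by simp))) (by linarith) k j
    linarith

/-- The contraction factor is at most one, so the perturbation terms can simply be added up. Their
linear growth in `m` is harmless because `m` will be fixed. -/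
theorem IsPerturbedConsensus.contract_iterate {G : TimeVaryingDigraph N}
    (hpc : PiecewiseContinuousOnHalfLine G.laplacian) {T δ : ℝ} {r : Fin N}
    (hG : G.ConnectedWith T δ r) {F a : ℝ} (ha : 0 ≤ a) (hF : 0 ≤ F) {z : Fin N → ℝ → E} {D : ℝ}
    (hD : ∀ j k, ‖z j a - z k a‖ ≤ D) (m : ℕ)
    (h : G.IsPerturbedConsensus F a (a + m * (N * T)) z) (j k : Fin N) :
    ‖z j (a + m * (N * T)) - z k (a + m * (N * T))‖ ≤
      (1 - G.gain T δ ^ N / 2) ^ m * D + 2 * F * (m * (N * T)) := by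
  have hNT : 0 ≤ N * T := mul_nonneg (Nat.cast_nonneg _) hG.1.le
  have hgain : G.gain T δ ^ N ≤ 1 :=
    pow_le_one₀ (G.gain_pos T hG.2.1).le (G.gain_le_one hG.1.le hG.2.1)
  have hgain0 : 0 ≤ G.gain T δ ^ N := pow_nonneg (G.gain_pos T hG.2.1).le N
  induction m generalizing j k with
  | zero => simpa using hD j k
  | succ m ih =>
    have hend : a + (m + 1 : ℕ) * (N * T) = a + m * (N * T) + N * T := by push_cast; ring
    rw [hend] at h ⊢
    have hm0 : 0 ≤ m * (N * T) := by positivity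
    have h1 := (h.mono (by linarith) le_rfl).contract hpc hG (by linarith)
      (fun j k => ih (h.mono le_rfl (by linarith)) j k) j k
    refine h1.trans ?_
    have h2 : (1 - G.gain T δ ^ N / 2) * (2 * F * (m * (N * T))) ≤ 2 * F * (m * (N * T)) :=
      mul_le_of_le_one_left (by positivity) (by linarith)
    rw [pow_succ]
    push_cast
    linarith

end TimeVaryingDigraph

/-! ### Growth of the flow via generalized eigenspaces -/

section Flow

variable {E : Type*} [NormedAddCommGroup E] [NormedSpace ℂ E]

/-- The flow `e^{tA}` of the linear differential equation `ẋ = A x`. -/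
noncomputable def flow (A : E →L[ℂ] E) (t : ℝ) : E →L[ℂ] E := NormedSpace.exp (t • A)

theorem flow_zero (A : E →L[ℂ] E) : flow A 0 = 1 := by
  rw [flow, zero_smul, NormedSpace.exp_zero]

theorem Commute.flow_left {A P : E →L[ℂ] E} (h : Commute A P) (t : ℝ) : Commute (flow A t) P := by
  let _ : NormedAlgebra ℚ (E →L[ℂ] E) := NormedAlgebra.restrictScalars ℚ ℝ (E →L[ℂ] E)
  exact (h.smul_left t).exp_left

theorem HasDerivAt.real_clm_apply {c : ℝ → E →L[ℂ] E} {c' : E →L[ℂ] E} {u : ℝ → E} {u' : E} {t : ℝ}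
    (hc : HasDerivAt c c' t) (hu : HasDerivAt u u' t) :
    HasDerivAt (fun s => c s (u s)) (c' (u t) + c t u') t :=
  (ContinuousLinearMap.restrictScalarsL ℂ E E ℝ ℝ).hasFDerivAt.comp_hasDerivAt t hc
    |>.clm_apply hu

theorem eq_zero_of_mem_maxGenEigenspace_of_not_hasEigenvalue {f : Module.End ℂ E} {μ : ℂ}
    (hμ : ¬ f.HasEigenvalue μ) {v : E} (hv : v ∈ f.maxGenEigenspace μ) : v = 0 := by
  obtain ⟨k, hk⟩ := (Module.End.mem_maxGenEigenspace _ _ _).1 hv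
  have hbot : f.eigenspace μ = ⊥ := by
    by_contra h
    exact hμ (Module.End.hasEigenvalue_iff.2 h)
  rw [Module.End.eigenspace_def, LinearMap.ker_eq_bot] at hbot
  have hinj : Function.Injective ⇑((f - μ • (1 : Module.End ℂ E)) ^ k) := by
    rw [Module.End.coe_pow]
    exact hbot.iterate k
  exact hinj (hk.trans (map_zero _).symm)

theorem mapsTo_biSup_maxGenEigenspace (f : Module.End ℂ E) (S : Set ℂ) {v : E}
    (hv : v ∈ ⨆ μ ∈ S, f.maxGenEigenspace μ) : f v ∈ ⨆ μ ∈ S, f.maxGenEigenspace μ := by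
  have : ⨆ μ ∈ S, f.maxGenEigenspace μ ≤ (⨆ μ ∈ S, f.maxGenEigenspace μ).comap f :=
    iSup₂_le fun μ hμ v hv => (le_biSup (fun μ => f.maxGenEigenspace μ) hμ)
      (Module.End.mapsTo_maxGenEigenspace_of_comm (Commute.refl f) μ hv)
  exact this hv

theorem flow_mul_comm (A : E →L[ℂ] E) (t : ℝ) : flow A t * A = A * flow A t :=
  (Commute.refl A).flow_left t

variable [FiniteDimensional ℂ E]

theorem flow_add (A : E →L[ℂ] E) (s t : ℝ) : flow A (s + t) = flow A s * flow A t := by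
  have : CompleteSpace E := FiniteDimensional.complete ℂ E
  let _ : NormedAlgebra ℚ (E →L[ℂ] E) := NormedAlgebra.restrictScalars ℚ ℝ (E →L[ℂ] E)
  rw [flow, add_smul]
  exact NormedSpace.exp_add_of_commute (((Commute.refl A).smul_left s).smul_right t)

theorem flow_add_apply (A : E →L[ℂ] E) (s t : ℝ) (v : E) :
    flow A (s + t) v = flow A s (flow A t v) := by rw [flow_add]; rfl

theorem hasDerivAt_flow (A : E →L[ℂ] E) (t : ℝ) : HasDerivAt (flow A) (flow A t * A) t := by
  have : CompleteSpace E := FiniteDimensional.complete ℂ E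
  exact hasDerivAt_exp_smul_const (𝕂 := ℝ) A t

theorem continuous_flow (A : E →L[ℂ] E) : Continuous (flow A) :=
  continuous_iff_continuousAt.2 fun t => (hasDerivAt_flow A t).continuousAt

theorem hasDerivAt_flow_apply (A : E →L[ℂ] E) (v : E) (t : ℝ) :
    HasDerivAt (fun t => flow A t v) (A (flow A t v)) t := by
  refine ((hasDerivAt_flow A t).real_clm_apply (hasDerivAt_const t v)).congr_deriv ?_
  rw [flow_mul_comm]
  simp

/-- Variation of constants, in differential form. -/
theorem hasDerivAt_flow_sub_apply {A : E →L[ℂ] E} {y : ℝ → E} {f : E} {t : ℝ} (τ : ℝ)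
    (hy : HasDerivAt y (A (y t) + f) t) :
    HasDerivAt (fun s => flow A (τ - s) (y s)) (flow A (τ - t) f) t := by
  have h1 : HasDerivAt (fun s => flow A (τ - s)) (-(flow A (τ - t) * A)) t := by
    have h2 := (hasDerivAt_flow A (τ - t)).scomp t ((hasDerivAt_id t).const_sub τ)
    rw [neg_one_smul] at h2
    exact h2
  refine (h1.real_clm_apply hy).congr_deriv ?_
  simp

theorem continuousOn_flow_sub_apply (A : E →L[ℂ] E) {y : ℝ → E} {s : Set ℝ} (τ : ℝ)
    (hy : ContinuousOn y s) : ContinuousOn (fun t => flow A (τ - t) (y t)) s :=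
  ContinuousOn.clm_apply ((continuous_flow A).comp (continuous_const.sub continuous_id)).continuousOn
    hy

/-- The scalar part `μ` commutes with everything and splits off. On the generalized eigenspace of
`μ` the remaining factor is the exponential of a nilpotent operator. -/
theorem flow_eq_smul_flow_sub (A : E →L[ℂ] E) (μ : ℂ) (t : ℝ) :
    flow A t = Complex.exp (μ * t) • flow (A - μ • 1) t := by
  have : CompleteSpace E := FiniteDimensional.complete ℂ E
  let _ : NormedAlgebra ℚ (E →L[ℂ] E) := NormedAlgebra.restrictScalars ℚ ℝ (E →L[ℂ] E)
  have h1 : t • A = algebraMap ℂ (E →L[ℂ] E) (μ * t) + t • (A - μ • 1) := by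
    ext v
    simp [Algebra.algebraMap_eq_smul_one, smul_sub, mul_smul, ← Complex.coe_smul,
      smul_comm μ (t : ℂ)]
  rw [flow, h1, NormedSpace.exp_add_of_commute (Algebra.commutes _ _),
    ← NormedSpace.algebraMap_exp_comm, ← Complex.exp_eq_exp_ℂ, Algebra.algebraMap_eq_smul_one,
    smul_mul_assoc, one_mul, flow]

theorem flow_apply_eq_sum {A : E →L[ℂ] E} {k : ℕ} {v : E} (h : (A ^ k) v = 0) (t : ℝ) :
    flow A t v = ∑ j ∈ Finset.range k, (((j.factorial : ℝ))⁻¹ * t ^ j) • (A ^ j) v := by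
  have : CompleteSpace E := FiniteDimensional.complete ℂ E
  have hs := NormedSpace.exp_series_hasSum_exp' (𝕂 := ℝ) (t • A)
  have hs' := hs.mapL (ContinuousLinearMap.apply ℂ E v)
  refine hs'.unique ?_
  have hz : ∀ j ∉ Finset.range k, (((j.factorial : ℝ))⁻¹ * t ^ j) • (A ^ j) v = 0 := by
    intro j hj
    obtain ⟨i, rfl⟩ := Nat.exists_eq_add_of_le (not_lt.1 (fun h => hj (Finset.mem_range.2 h)))
    have hA : (A ^ (i + k)) v = (A ^ i) ((A ^ k) v) := by rw [pow_add]; rfl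
    rw [add_comm, hA, h, map_zero, smul_zero]
  have hfin := hasSum_sum_of_ne_finset_zero (L := SummationFilter.unconditional ℕ) hz
  refine HasSum.congr_fun hfin fun j => ?_
  simp [smul_pow, mul_smul]

/-- The exponential series stops after `k` terms, and each power of `|t|` is absorbed by `(ε |t|)^j
/ j! ≤ e^{ε |t|}`. -/
theorem norm_flow_apply_le_of_pow_eq_zero {A : E →L[ℂ] E} {k : ℕ} {v : E} (h : (A ^ k) v = 0)
    {ε : ℝ} (hε : 0 < ε) : ∃ c : ℝ, 0 ≤ c ∧ ∀ t : ℝ, ‖flow A t v‖ ≤ c * Real.exp (ε * |t|) := by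
  refine ⟨∑ j ∈ Finset.range k, (ε ^ j)⁻¹ * ‖(A ^ j) v‖, by positivity, fun t => ?_⟩
  rw [flow_apply_eq_sum h, Finset.sum_mul]
  refine (norm_sum_le _ _).trans (Finset.sum_le_sum fun j _ => ?_)
  have h1 := Real.pow_div_factorial_le_exp (x := ε * |t|) (by positivity) j
  rw [mul_pow] at h1
  have h2 : ((j.factorial : ℝ))⁻¹ * |t| ^ j ≤ (ε ^ j)⁻¹ * Real.exp (ε * |t|) := by
    rw [← mul_le_mul_iff_right₀ (pow_pos hε j), ← mul_assoc (ε ^ j) (ε ^ j)⁻¹,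
      mul_inv_cancel₀ (pow_pos hε j).ne', one_mul]
    calc _ = ε ^ j * |t| ^ j / j.factorial := by ring
      _ ≤ _ := h1
  rw [norm_smul, norm_mul, norm_inv, norm_pow, Real.norm_eq_abs t, Real.norm_natCast]
  calc _ ≤ (ε ^ j)⁻¹ * Real.exp (ε * |t|) * ‖(A ^ j) v‖ :=
        mul_le_mul_of_nonneg_right h2 (norm_nonneg _)
    _ = _ := by ring

/-- Growth of the flow on a generalized eigenspace. -/
theorem norm_flow_apply_le_of_mem_maxGenEigenspace {A : E →L[ℂ] E} {μ : ℂ} {v : E}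
    (hv : v ∈ Module.End.maxGenEigenspace (A : Module.End ℂ E) μ) {ε : ℝ} (hε : 0 < ε) :
    ∃ c : ℝ, 0 ≤ c ∧ ∀ t : ℝ, ‖flow A t v‖ ≤ c * Real.exp (μ.re * t + ε * |t|) := by
  obtain ⟨k, hk⟩ := (Module.End.mem_maxGenEigenspace _ _ _).1 hv
  have hk' : ((A - μ • 1) ^ k) v = 0 := by
    rw [← hk, ← ContinuousLinearMap.coe_coe, ContinuousLinearMap.toLinearMap_pow]
    rfl
  obtain ⟨c, hc0, hc⟩ := norm_flow_apply_le_of_pow_eq_zero hk' hε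
  refine ⟨c, hc0, fun t => ?_⟩
  rw [flow_eq_smul_flow_sub A μ t, smul_apply, norm_smul, Complex.norm_exp,
    Real.exp_add]
  have : (μ * t).re = μ.re * t := by simp
  rw [this]
  calc _ ≤ Real.exp (μ.re * t) * (c * Real.exp (ε * |t|)) :=
        mul_le_mul_of_nonneg_left (hc t) (Real.exp_pos _).le
    _ = _ := by ring

/-- Growth of the flow on a sum of generalized eigenspaces, for times in `J`. -/
theorem norm_flow_apply_le_of_mem_biSup {A : E →L[ℂ] E} {S : Set ℂ} {J : Set ℝ} {σ : ℝ → ℝ}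
    {ε : ℝ} (hε : 0 < ε)
    (h : ∀ μ ∈ S, Module.End.HasEigenvalue (A : Module.End ℂ E) μ → ∀ t ∈ J,
      μ.re * t + ε * |t| ≤ σ t) {v : E}
    (hv : v ∈ ⨆ μ ∈ S, Module.End.maxGenEigenspace (A : Module.End ℂ E) μ) :
    ∃ c : ℝ, 0 ≤ c ∧ ∀ t ∈ J, ‖flow A t v‖ ≤ c * Real.exp (σ t) := by
  rw [iSup_subtype'] at hv
  induction hv using Submodule.iSup_induction' with
  | mem μ v hv =>
    by_cases hμ : Module.End.HasEigenvalue (A : Module.End ℂ E) (μ : ℂ)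
    · obtain ⟨c, hc0, hc⟩ := norm_flow_apply_le_of_mem_maxGenEigenspace hv hε
      refine ⟨c, hc0, fun t ht => (hc t).trans ?_⟩
      exact mul_le_mul_of_nonneg_left (Real.exp_le_exp.2 (h μ μ.2 hμ t ht)) hc0
    · rw [eq_zero_of_mem_maxGenEigenspace_of_not_hasEigenvalue hμ hv]
      exact ⟨0, le_rfl, fun t _ => by simp⟩
  | zero => exact ⟨0, le_rfl, fun t _ => by simp⟩
  | add v w _ _ hv hw =>
    obtain ⟨c, hc0, hc⟩ := hv
    obtain ⟨d, hd0, hd⟩ := hw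
    refine ⟨c + d, add_nonneg hc0 hd0, fun t ht => ?_⟩
    rw [map_add, add_mul]
    exact (norm_add_le _ _).trans (add_le_add (hc t ht) (hd t ht))

/-- Uniform form of pointwise growth bounds. -/
theorem exists_norm_le_of_pointwise (L : ℝ → E →L[ℂ] E) (J : Set ℝ) (σ : ℝ → ℝ)
    (h : ∀ v, ∃ c : ℝ, ∀ t ∈ J, ‖L t v‖ ≤ c * Real.exp (σ t)) :
    ∃ c : ℝ, 0 < c ∧ ∀ t ∈ J, ‖L t‖ ≤ c * Real.exp (σ t) := by
  have : CompleteSpace E := FiniteDimensional.complete ℂ E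
  -- After rescaling by `e^{-σ t}` the operators are pointwise bounded, hence uniformly bounded.
  obtain ⟨C, hC⟩ := banach_steinhaus (g := fun t : J => (Real.exp (-σ t)) • L t) (fun v => by
    obtain ⟨c, hc⟩ := h v
    refine ⟨c, fun t => ?_⟩
    rw [smul_apply, norm_smul, Real.norm_of_nonneg (Real.exp_pos _).le]
    calc _ ≤ Real.exp (-σ t) * (c * Real.exp (σ t)) :=
          mul_le_mul_of_nonneg_left (hc t t.2) (Real.exp_pos _).le
      _ = c * (Real.exp (-σ t) * Real.exp (σ t)) := by ring
      _ = c := by rw [← Real.exp_add]; simp)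
  refine ⟨|C| + 1, by positivity, fun t ht => ?_⟩
  have h1 := hC ⟨t, ht⟩
  rw [norm_smul, Real.norm_of_nonneg (Real.exp_pos _).le] at h1
  calc ‖L t‖ = (Real.exp (-σ t) * ‖L t‖) * Real.exp (σ t) := by
        rw [mul_right_comm, ← Real.exp_add]; simp
    _ ≤ _ := mul_le_mul_of_nonneg_right (h1.trans ((le_abs_self C).trans (by linarith)))
        (Real.exp_pos _).le

/-- There are only finitely many eigenvalues. The factor `2` leaves room for the loss `e^{γ t}` on
generalized eigenspaces, so that decay at rate `γ` remains. -/
theorem exists_gap (f : Module.End ℂ E) : ∃ γ : ℝ, 0 < γ ∧ ∀ μ : ℂ, f.HasEigenvalue μ → μ.re < 0 →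
    μ.re ≤ -(2 * γ) := by
  have hfin : {μ : ℂ | f.HasEigenvalue μ}.Finite := by
    refine (Module.End.finite_spectrum f).subset fun μ hμ => hμ.mem_spectrum
  have hev : ∀ᶠ γ : ℝ in 𝓝[>] 0, ∀ μ ∈ {μ : ℂ | f.HasEigenvalue μ}, μ.re < 0 →
      μ.re ≤ -(2 * γ) := by
    rw [hfin.eventually_all]
    intro μ _
    by_cases h : μ.re < 0
    · have : ∀ᶠ γ : ℝ in 𝓝 0, γ < -μ.re / 2 := gt_mem_nhds (by linarith)
      filter_upwards [nhdsWithin_le_nhds this] with γ hγ _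
      linarith
    · exact Eventually.of_forall fun _ h' => absurd h' h
  obtain ⟨γ, h1, h2⟩ := (hev.and self_mem_nhdsWithin).exists
  exact ⟨γ, h2, h1⟩

theorem iSup_maxGenEigenspace_eq_top_of_forall {f : Module.End ℂ E} {S : Set ℂ}
    (h : ∀ μ, f.HasEigenvalue μ → μ ∈ S) : ⨆ μ ∈ S, f.maxGenEigenspace μ = ⊤ := by
  rw [eq_top_iff, ← Module.End.iSup_maxGenEigenspace_eq_top f]
  refine iSup_le fun μ => ?_
  by_cases hμ : f.HasEigenvalue μ
  · exact le_biSup (fun μ => f.maxGenEigenspace μ) (h μ hμ)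
  · intro v hv
    rw [eq_zero_of_mem_maxGenEigenspace_of_not_hasEigenvalue hμ hv]
    exact zero_mem _

/-- The flow of a Hurwitz operator decays exponentially. -/
theorem exists_norm_flow_le_of_hurwitz {A : E →L[ℂ] E}
    (hA : ∀ μ, Module.End.HasEigenvalue (A : Module.End ℂ E) μ → μ.re < 0) :
    ∃ γ : ℝ, 0 < γ ∧ ∃ c : ℝ, 0 < c ∧ ∀ t : ℝ, 0 ≤ t → ‖flow A t‖ ≤ c * Real.exp (-γ * t) := by
  obtain ⟨γ, hγ, hgap⟩ := exists_gap (A : Module.End ℂ E)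
  refine ⟨γ, hγ, exists_norm_le_of_pointwise (flow A) (Set.Ici 0) (fun t => -γ * t) fun v => ?_⟩
  obtain ⟨c, -, hc⟩ := norm_flow_apply_le_of_mem_biSup (A := A) (S := {μ | μ.re < 0})
    (J := Set.Ici 0) (σ := fun t => -γ * t) hγ (v := v) (fun μ _ hev t ht => by
      rw [abs_of_nonneg (Set.mem_Ici.1 ht)]
      nlinarith [hgap μ hev (hA μ hev), Set.mem_Ici.1 ht])
    (by rw [iSup_maxGenEigenspace_eq_top_of_forall (S := {μ | μ.re < 0}) hA]; trivial)
  exact ⟨c, hc⟩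

/-- If no eigenvalue has positive real part, the state space splits into a central part, on which
the flow grows subexponentially in both time directions, and an exponentially stable part. -/
theorem exists_central_projection {A : E →L[ℂ] E}
    (hA : ∀ μ, Module.End.HasEigenvalue (A : Module.End ℂ E) μ → μ.re ≤ 0) :
    ∃ P : E →L[ℂ] E, Commute A P ∧
      (∀ ε : ℝ, 0 < ε → ∃ c : ℝ, 0 < c ∧ ∀ t, ‖flow A t * P‖ ≤ c * Real.exp (ε * |t|)) ∧
      ∃ γ : ℝ, 0 < γ ∧ ∃ c : ℝ, 0 < c ∧
        ∀ t, 0 ≤ t → ‖flow A t * (1 - P)‖ ≤ c * Real.exp (-γ * t) := by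
  set f : Module.End ℂ E := (A : Module.End ℂ E) with hf
  set V : Submodule ℂ E := ⨆ μ ∈ {μ : ℂ | μ.re = 0}, f.maxGenEigenspace μ with hV
  set W : Submodule ℂ E := ⨆ μ ∈ {μ : ℂ | μ.re < 0}, f.maxGenEigenspace μ with hW
  -- Generalized eigenspaces are independent and span the space, and by `hA` every eigenvalue falls
  -- into one of the two classes.
  have hcompl : IsCompl V W := by
    constructor
    · refine (Module.End.independent_maxGenEigenspace f).disjoint_biSup_biSup ?_
      exact Set.disjoint_left.2 fun μ h1 h2 => (ne_of_lt h2) h1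
    · rw [codisjoint_iff, eq_top_iff, ← iSup_maxGenEigenspace_eq_top_of_forall (f := f)
        (S := {μ | μ.re ≤ 0}) hA]
      refine iSup₂_le fun μ hμ => ?_
      rcases lt_or_eq_of_le (show μ.re ≤ 0 from hμ) with h | h
      · exact le_sup_of_le_right (le_biSup (fun μ => f.maxGenEigenspace μ) h)
      · exact le_sup_of_le_left (le_biSup (fun μ => f.maxGenEigenspace μ) h)
  set P : E →L[ℂ] E := LinearMap.toContinuousLinearMap (V.projection W hcompl) with hP
  have hPV : ∀ v, P v ∈ V := fun v => Submodule.projection_apply_mem hcompl v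
  have hPW : ∀ v, v - P v ∈ W := fun v => Submodule.sub_projection_mem hcompl v
  have hPV' : ∀ v ∈ V, P v = v := fun v hv =>
    Submodule.projection_apply_of_mem_left hcompl hv
  have hPW' : ∀ v ∈ W, P v = 0 := fun v hv =>
    (Submodule.projection_apply_eq_zero_iff hcompl).2 hv
  refine ⟨P, ?_, fun ε hε => ?_, ?_⟩
  · refine ContinuousLinearMap.ext fun v => ?_
    have h1 : A (P v) ∈ V := mapsTo_biSup_maxGenEigenspace f _ (hPV v)
    have h2 : A (v - P v) ∈ W := mapsTo_biSup_maxGenEigenspace f _ (hPW v)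
    have h3 := hPW' _ h2
    rw [map_sub, map_sub, hPV' _ h1, sub_eq_zero] at h3
    exact h3.symm
  · obtain ⟨c, hc0, hc⟩ := exists_norm_le_of_pointwise (fun t => flow A t * P) Set.univ
      (fun t => ε * |t|) (fun v => by
        obtain ⟨c, -, hc⟩ := norm_flow_apply_le_of_mem_biSup (A := A) (S := {μ : ℂ | μ.re = 0})
          (J := Set.univ) (σ := fun t => ε * |t|) hε (v := P v) (fun μ hμ _ t _ => by
            rw [show μ.re = 0 from hμ]; simp) (hPV v)
        exact ⟨c, hc⟩)
    exact ⟨c, hc0, fun t => hc t trivial⟩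
  · obtain ⟨γ, hγ, hgap⟩ := exists_gap f
    refine ⟨γ, hγ, exists_norm_le_of_pointwise (fun t => flow A t * (1 - P)) (Set.Ici 0)
      (fun t => -γ * t) fun v => ?_⟩
    obtain ⟨c, -, hc⟩ := norm_flow_apply_le_of_mem_biSup (A := A) (S := {μ | μ.re < 0})
      (J := Set.Ici 0) (σ := fun t => -γ * t) hγ (v := v - P v) (fun μ hμ hev t ht => by
        rw [abs_of_nonneg (Set.mem_Ici.1 ht)]
        nlinarith [hgap μ hev hμ, Set.mem_Ici.1 ht]) (hPW v)
    exact ⟨c, hc⟩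

end Flow

/-! ### Linear equations with exponentially decaying input -/

section Asymptotics

variable {E : Type*} [NormedAddCommGroup E] [NormedSpace ℂ E]

/-- Solutions of `ẏ = A y + f` on `[t₀, ∞)` with `‖f(t)‖ ≤ F e^{-α (t - t₀)}`, where the equation
may fail at the times in `Z`. -/
structure IsPerturbedSolution (Z : Set ℝ) (A : E →L[ℂ] E) (F α t₀ : ℝ) (y : ℝ → E) : Prop where
  continuousOn : ContinuousOn y (Set.Ici t₀)
  hasDerivAt : ∀ t, t₀ < t → t ∉ Z →
    ∃ f : E, ‖f‖ ≤ F * Real.exp (-α * (t - t₀)) ∧ HasDerivAt y (A (y t) + f) t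

theorem IsPerturbedSolution.weaken {Z : Set ℝ} {A : E →L[ℂ] E} {F α α' t₀ : ℝ} {y : ℝ → E}
    (h : IsPerturbedSolution Z A F α t₀ y) (hF : 0 ≤ F) (hα : α' ≤ α) :
    IsPerturbedSolution Z A F α' t₀ y := by
  refine ⟨h.continuousOn, fun t ht htZ => ?_⟩
  obtain ⟨f, hf, hd⟩ := h.hasDerivAt t ht htZ
  refine ⟨f, hf.trans (mul_le_mul_of_nonneg_left (Real.exp_le_exp.2 ?_) hF), hd⟩
  nlinarith

variable [FiniteDimensional ℂ E]

/-- Subtracting the free solution with the same initial value gives a perturbed solution starting at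
`0`. The final estimate then depends on `F` alone and not on `‖y t₀‖`. -/
theorem IsPerturbedSolution.sub_flow {Z : Set ℝ} {A : E →L[ℂ] E} {F α t₀ : ℝ} {y : ℝ → E}
    (h : IsPerturbedSolution Z A F α t₀ y) (v : E) :
    IsPerturbedSolution Z A F α t₀ (fun t => y t - flow A (t - t₀) v) := by
  have hflow : ∀ t, HasDerivAt (fun t => flow A (t - t₀) v) (A (flow A (t - t₀) v)) t := fun t =>
    (hasDerivAt_flow_apply A v (t - t₀)).comp_sub_const t t₀
  refine ⟨h.continuousOn.sub fun t _ => (hflow t).continuousAt.continuousWithinAt,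
    fun t ht htZ => ?_⟩
  obtain ⟨f, hf, hd⟩ := h.hasDerivAt t ht htZ
  refine ⟨f, hf, (hd.sub (hflow t)).congr_deriv ?_⟩
  rw [map_sub]
  abel

/-- Variation of constants estimate for a component on which the flow has a known growth. -/
theorem IsPerturbedSolution.norm_flow_sub_le {Z : Set ℝ} (hZ : ∀ a b, (Z ∩ Set.Ioo a b).Finite)
    {A Q : E →L[ℂ] E} (hQ : Commute A Q) {F α t₀ : ℝ} {y : ℝ → E}
    (h : IsPerturbedSolution Z A F α t₀ y) {τ a b c γ : ℝ} (ha : t₀ ≤ a)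
    (hab : a ≤ b) (hγ : γ ≠ α)
    (hflow : ∀ t ∈ Set.Ioo a b, ‖flow A (τ - t) * Q‖ ≤ c * Real.exp (-γ * (τ - t))) :
    ‖Q (flow A (τ - b) (y b)) - Q (flow A (τ - a) (y a))‖ ≤
      c * F / (γ - α) * (Real.exp (-γ * (τ - b) - α * (b - t₀))
        - Real.exp (-γ * (τ - a) - α * (a - t₀))) := by
  -- The comparison function is an antiderivative of `c F e^{-γ (τ - t)} e^{-α (t - t₀)}`, which is
  -- where `γ ≠ α` enters.
  have hmain := norm_sub_le_of_norm_hasDerivAt_le_off_finite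
    (g := fun t => Q (flow A (τ - t) (y t)))
    (B := fun t => c * F / (γ - α) * Real.exp (-γ * (τ - t) - α * (t - t₀))) (hZ a b) hab
    (Q.continuous.comp_continuousOn (continuousOn_flow_sub_apply A τ
      (h.continuousOn.mono fun t ht => ha.trans ht.1)))
    (by fun_prop)
    (fun t ht htZ => by
      obtain ⟨f, hf, hd⟩ := h.hasDerivAt t (ha.trans_lt ht.1) htZ
      have h1 := (Q.restrictScalars ℝ).hasFDerivAt.comp_hasDerivAt t
        (hasDerivAt_flow_sub_apply τ hd)
      have h2 : HasDerivAt (fun t => c * F / (γ - α) * Real.exp (-γ * (τ - t) - α * (t - t₀)))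
          (c * F / (γ - α) * (Real.exp (-γ * (τ - t) - α * (t - t₀))
            * (-γ * (-1) - α * 1))) t :=
        (((((hasDerivAt_id t).const_sub τ).const_mul (-γ)).sub
          (((hasDerivAt_id t).sub_const t₀).const_mul α)).exp).const_mul _
      refine ⟨_, _, h1, h2, ?_⟩
      have h3 : Q (flow A (τ - t) f) = (flow A (τ - t) * Q) f := by
        rw [(hQ.flow_left (τ - t)).eq]; rfl
      have h4 : c * F / (γ - α) * (Real.exp (-γ * (τ - t) - α * (t - t₀)) * (-γ * (-1) - α * 1))
          = c * Real.exp (-γ * (τ - t)) * (F * Real.exp (-α * (t - t₀))) := by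
        have : γ - α ≠ 0 := sub_ne_zero.2 hγ
        rw [show -γ * (τ - t) - α * (t - t₀) = -γ * (τ - t) + -α * (t - t₀) by ring, Real.exp_add]
        field_simp
      rw [h4]
      change ‖Q (flow A (τ - t) f)‖ ≤ _
      rw [h3]
      exact ((flow A (τ - t) * Q).le_opNorm f).trans (mul_le_mul (hflow t ht) hf (norm_nonneg _)
        ((norm_nonneg _).trans (hflow t ht))))
  rwa [mul_sub]

/-- Decay of a component on which the flow decays. -/
theorem IsPerturbedSolution.norm_le_of_stable {Z : Set ℝ}
    (hZ : ∀ a b, (Z ∩ Set.Ioo a b).Finite) {A Q : E →L[ℂ] E} (hQ : Commute A Q) {F α t₀ c γ : ℝ}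
    (hF : 0 ≤ F) (hα : α < γ) (hc : 0 ≤ c)
    (hflow : ∀ t, 0 ≤ t → ‖flow A t * Q‖ ≤ c * Real.exp (-γ * t)) {y : ℝ → E}
    (h : IsPerturbedSolution Z A F α t₀ y) {t : ℝ} (ht : t₀ ≤ t) :
    ‖Q (y t)‖ ≤ c * (‖y t₀‖ + F / (γ - α)) * Real.exp (-α * (t - t₀)) := by
  have h1 := h.norm_flow_sub_le hZ hQ (τ := t) le_rfl ht hα.ne'
    (fun s hs => hflow (t - s) (sub_nonneg.2 hs.2.le))
  rw [sub_self, flow_zero, sub_self] at h1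
  have h2 : ‖Q (flow A (t - t₀) (y t₀))‖ ≤ c * ‖y t₀‖ * Real.exp (-α * (t - t₀)) := by
    have h3 : Q (flow A (t - t₀) (y t₀)) = (flow A (t - t₀) * Q) (y t₀) := by
      rw [(hQ.flow_left (t - t₀)).eq]; rfl
    rw [h3]
    refine ((flow A (t - t₀) * Q).le_opNorm _).trans ?_
    calc _ ≤ c * Real.exp (-α * (t - t₀)) * ‖y t₀‖ := by
          refine mul_le_mul_of_nonneg_right ((hflow _ (sub_nonneg.2 ht)).trans ?_) (norm_nonneg _)
          refine mul_le_mul_of_nonneg_left (Real.exp_le_exp.2 ?_) hc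
          nlinarith
      _ = _ := by ring
  have h5 : c * F / (γ - α) * (Real.exp (-γ * 0 - α * (t - t₀))
        - Real.exp (-γ * (t - t₀) - α * 0)) ≤ c * (F / (γ - α)) * Real.exp (-α * (t - t₀)) := by
    rw [mul_div_assoc]
    refine mul_le_mul_of_nonneg_left ?_ (mul_nonneg hc (div_nonneg hF (by linarith)))
    rw [show -γ * 0 - α * (t - t₀) = -α * (t - t₀) by ring]
    linarith [Real.exp_pos (-γ * (t - t₀) - α * 0)]
  have h6 : ‖Q (y t)‖ ≤ ‖Q (y t) - Q (flow A (t - t₀) (y t₀))‖ + ‖Q (flow A (t - t₀) (y t₀))‖ := by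
    simpa using norm_add_le (Q (y t) - Q (flow A (t - t₀) (y t₀))) (Q (flow A (t - t₀) (y t₀)))
  have h7 : ‖Q (y t) - Q (flow A (t - t₀) (y t₀))‖ ≤ _ := h1.trans h5
  calc _ ≤ _ := h6.trans (add_le_add h7 h2)
    _ = _ := by ring

/-- A component on which the flow grows subexponentially in backward time converges to a
solution of the unperturbed equation. -/
theorem IsPerturbedSolution.exists_limit {Z : Set ℝ}
    (hZ : ∀ a b, (Z ∩ Set.Ioo a b).Finite) {A Q : E →L[ℂ] E} (hQ : Commute A Q) {F α ε t₀ c : ℝ}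
    (hF : 0 ≤ F) (hε : ε < α) (hc : 0 ≤ c)
    (hflow : ∀ t, ‖flow A t * Q‖ ≤ c * Real.exp (ε * |t|)) {y : ℝ → E}
    (h : IsPerturbedSolution Z A F α t₀ y) :
    ∃ ξ : E, ∀ t, t₀ ≤ t →
      ‖Q (y t) - flow A (t - t₀) ξ‖ ≤ c * F / (α - ε) * Real.exp (-α * (t - t₀)) := by
  have : CompleteSpace E := FiniteDimensional.complete ℂ E
  -- For `τ ≤ a` the flow runs backward and `|τ - s| = -(τ - s)`, so the previous estimate applies
  -- with `γ = ε`. As `ε < α`, its coefficient is negative and the term at `b` can be dropped, which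
  -- makes the bound uniform in `b`.
  have key : ∀ τ a b, τ ≤ a → t₀ ≤ a → a ≤ b →
      ‖Q (flow A (τ - b) (y b)) - Q (flow A (τ - a) (y a))‖ ≤
        c * F / (α - ε) * Real.exp (-ε * (τ - a) - α * (a - t₀)) := by
    intro τ a b hτ ha hab
    refine (h.norm_flow_sub_le hZ hQ (τ := τ) (c := c) (γ := ε) ha hab hε.ne fun s hs => ?_).trans ?_
    · refine (hflow (τ - s)).trans (le_of_eq ?_)
      rw [abs_of_nonpos (by linarith [hs.1])]
      ring_nf
    · have hcoef : c * F / (ε - α) = -(c * F / (α - ε)) := by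
        rw [← neg_sub α ε, div_neg]
      have hnn : 0 ≤ c * F / (α - ε) := div_nonneg (mul_nonneg hc hF) (by linarith)
      rw [hcoef]
      nlinarith [mul_nonneg hnn (Real.exp_pos (-ε * (τ - b) - α * (b - t₀))).le]
  -- The limit of the states pulled back to time `t₀` is the initial value of the asymptotic free
  -- solution.
  have hcauchy : CauchySeq (fun n : ℕ => Q (flow A (t₀ - (t₀ + n)) (y (t₀ + n)))) := by
    refine cauchySeq_of_le_tendsto_0'
      (fun n : ℕ => c * F / (α - ε) * Real.exp (-(α - ε) * n)) (fun n m hnm => ?_) ?_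
    · rw [dist_comm, dist_eq_norm]
      refine (key t₀ (t₀ + n) (t₀ + m) (by simp) (by simp) (by simpa using hnm)).trans
        (le_of_eq ?_)
      ring_nf
    · have h1 : Tendsto (fun n : ℕ => -(α - ε) * (n : ℝ)) atTop atBot :=
        tendsto_natCast_atTop_atTop.const_mul_atTop_of_neg (by linarith)
      simpa using (Real.tendsto_exp_atBot.comp h1).const_mul (c * F / (α - ε))
  obtain ⟨ξ, hξ⟩ := cauchySeq_tendsto_of_complete hcauchy
  refine ⟨ξ, fun t ht => ?_⟩
  have hlim : Tendsto (fun n : ℕ => ‖flow A (t - t₀) (Q (flow A (t₀ - (t₀ + n)) (y (t₀ + n))))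
      - Q (y t)‖) atTop (𝓝 ‖flow A (t - t₀) ξ - Q (y t)‖) :=
    ((((flow A (t - t₀)).continuous.tendsto ξ).comp hξ).sub_const _).norm
  rw [norm_sub_rev]
  refine le_of_tendsto hlim ?_
  filter_upwards [eventually_ge_atTop ⌈t - t₀⌉₊] with n hn
  have hn' : t ≤ t₀ + n := by
    have := Nat.ceil_le.1 hn
    linarith
  -- The flow over `t - t₀` turns the pull-back to `t₀` into the pull-back to `t`, so `key` with `τ
  -- = a = t` bounds each term of the sequence.
  have h1 := key t t (t₀ + n) le_rfl ht hn'
  rw [sub_self, flow_zero] at h1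
  have h2 : flow A (t - t₀) (Q (flow A (t₀ - (t₀ + n)) (y (t₀ + n))))
      = Q (flow A (t - (t₀ + n)) (y (t₀ + n))) := by
    have h3 : ∀ v, flow A (t - t₀) (Q v) = Q (flow A (t - t₀) v) := fun v =>
      congrArg (fun L : E →L[ℂ] E => L v) (hQ.flow_left (t - t₀)).eq
    rw [h3, ← flow_add_apply]
    congr 3
    ring
  rw [h2]
  refine h1.trans (le_of_eq ?_)
  congr 2
  ring

/-- If no eigenvalue of `A` has positive real part, then solutions of `ẏ = A y + f` with
exponentially decaying `f` converge exponentially to solutions of `ẋ = A x`. -/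
theorem exists_asymptotic_solution {A : E →L[ℂ] E}
    (hA : ∀ μ, Module.End.HasEigenvalue (A : Module.End ℂ E) μ → μ.re ≤ 0) {α : ℝ} (hα : 0 < α) :
    ∃ α' : ℝ, 0 < α' ∧ α' ≤ α ∧ ∃ c : ℝ, 0 < c ∧ ∀ (Z : Set ℝ),
      (∀ a b, (Z ∩ Set.Ioo a b).Finite) → ∀ (F t₀ : ℝ) (y : ℝ → E), 0 ≤ F →
      IsPerturbedSolution Z A F α t₀ y →
      ∃ ξ : E, ∀ t, t₀ ≤ t → ‖y t - flow A (t - t₀) ξ‖ ≤ c * F * Real.exp (-α' * (t - t₀)) := by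
  obtain ⟨P, hP, hcentral, γ, hγ, c₂, hc₂, hstable⟩ := exists_central_projection hA
  -- Any `ε` strictly between `0` and `α` would do; likewise `γ / 2` below keeps `α'` strictly under
  -- the stable rate.
  obtain ⟨c₁, hc₁, hcentral⟩ := hcentral (α / 2) (by linarith)
  set α' := min α (γ / 2) with hα'
  have hα'0 : 0 < α' := lt_min hα (by linarith)
  have hα'γ : α' < γ := (min_le_right _ _).trans_lt (by linarith)
  refine ⟨α', hα'0, min_le_left _ _, c₁ / (α - α / 2) + c₂ / (γ - α'),
    add_pos (div_pos hc₁ (by linarith)) (div_pos hc₂ (by linarith)),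
    fun Z hZ F t₀ y hF hy => ?_⟩
  have hy' := hy.sub_flow (y t₀)
  obtain ⟨ξ, hξ⟩ := hy'.exists_limit hZ hP hF (by linarith) hc₁.le hcentral
  refine ⟨y t₀ + ξ, fun t ht => ?_⟩
  have h1 := hξ t ht
  have h2 := (hy'.weaken hF (min_le_left α (γ / 2))).norm_le_of_stable hZ
    ((Commute.one_right A).sub_right hP) hF hα'γ hc₂.le hstable ht
  simp only [sub_self, flow_zero, one_apply_eq_self, norm_zero, zero_add] at h2
  set w := y t - flow A (t - t₀) (y t₀) with hw
  have h3 : y t - flow A (t - t₀) (y t₀ + ξ)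
      = (P w - flow A (t - t₀) ξ) + (1 - P : E →L[ℂ] E) w := by
    rw [map_add, sub_apply, one_apply_eq_self, hw]
    abel
  have h4 : Real.exp (-α * (t - t₀)) ≤ Real.exp (-α' * (t - t₀)) := by
    refine Real.exp_le_exp.2 ?_
    nlinarith [min_le_left α (γ / 2)]
  rw [h3]
  have h5 : c₁ * F / (α - α / 2) * Real.exp (-α * (t - t₀))
      ≤ c₁ * F / (α - α / 2) * Real.exp (-α' * (t - t₀)) :=
    mul_le_mul_of_nonneg_left h4 (div_nonneg (mul_nonneg hc₁.le hF) (by linarith))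
  calc _ ≤ _ := (norm_add_le _ _).trans (add_le_add (h1.trans h5) h2)
    _ = _ := by ring

/-- Subexponential growth of the flow in forward time. -/
theorem exists_norm_flow_le_of_nonpos {A : E →L[ℂ] E}
    (hA : ∀ μ, Module.End.HasEigenvalue (A : Module.End ℂ E) μ → μ.re ≤ 0) {ε : ℝ} (hε : 0 < ε) :
    ∃ c : ℝ, 0 < c ∧ ∀ t, 0 ≤ t → ‖flow A t‖ ≤ c * Real.exp (ε * t) := by
  obtain ⟨P, -, hcentral, γ, hγ, c₂, hc₂, hstable⟩ := exists_central_projection hA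
  obtain ⟨c₁, hc₁, hcentral⟩ := hcentral ε hε
  refine ⟨c₁ + c₂, add_pos hc₁ hc₂, fun t ht => ?_⟩
  have h1 : flow A t = flow A t * P + flow A t * (1 - P) := by rw [← mul_add]; simp
  have h2 := hcentral t
  rw [abs_of_nonneg ht] at h2
  have h3 : Real.exp (-γ * t) ≤ Real.exp (ε * t) := Real.exp_le_exp.2 (by nlinarith)
  rw [h1, add_mul]
  exact (norm_add_le _ _).trans (add_le_add h2 ((hstable t ht).trans
    (mul_le_mul_of_nonneg_left h3 hc₂.le)))

end Asymptotics

/-! ### Decay of the disagreement for coupled copies of `ẋ = A x` -/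

namespace TimeVaryingDigraph

variable {N : ℕ} {E : Type*} [NormedAddCommGroup E] [NormedSpace ℂ E]

/-- Solutions on `[a, b]` of `ṡ_k = A s_k + ∑_j a_kj (s_j - s_k)` with a perturbation of norm at
most `F`. -/
structure IsPerturbedSync (G : TimeVaryingDigraph N) (A : E →L[ℂ] E) (F a b : ℝ)
    (s : Fin N → ℝ → E) : Prop where
  continuousOn : ∀ k, ContinuousOn (s k) (Set.Icc a b)
  hasDerivAt : ∀ k, ∀ t ∈ Set.Ioo a b, t ∉ G.switchTimes → ∃ f : E, ‖f‖ ≤ F ∧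
    HasDerivAt (s k) (A (s k t) + (∑ j, G.weight t k j • (s j t - s k t) + f)) t

theorem norm_sum_weight_smul_le (G : TimeVaryingDigraph N) {t : ℝ} (ht : 0 ≤ t) (k : Fin N)
    {v : Fin N → E} {D : ℝ} (hv : ∀ j, ‖v j‖ ≤ D) : ‖∑ j, G.weight t k j • v j‖ ≤ G.rate * D := by
  have : G.rate * D = ∑ _j : Fin N, G.wmax * D := by simp [rate, mul_assoc]
  rw [this]
  refine norm_sum_le_of_le _ fun j _ => ?_
  rw [norm_smul, Real.norm_of_nonneg (G.weight_nonneg ht k j)]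
  exact mul_le_mul (G.weight_le ht k j) (hv j) (norm_nonneg _) G.wmax_pos.le

variable [FiniteDimensional ℂ E]

theorem exists_norm_flow_le (A : E →L[ℂ] E) (τ : ℝ) :
    ∃ C : ℝ, 0 < C ∧ ∀ t ∈ Set.Icc (-τ) τ, ‖flow A t‖ ≤ C := by
  obtain ⟨C, hC⟩ := isCompact_Icc.exists_bound_of_continuousOn (s := Set.Icc (-τ) τ)
    (continuous_flow A).continuousOn
  exact ⟨|C| + 1, by positivity, fun t ht => (hC t ht).trans
    ((le_abs_self C).trans (by linarith))⟩

/-- In coordinates moving with the flow, the dynamics is a perturbed consensus dynamics. -/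
theorem IsPerturbedSync.isPerturbedConsensus {G : TimeVaryingDigraph N} {A : E →L[ℂ] E}
    {F C a b : ℝ} {s : Fin N → ℝ → E} (h : G.IsPerturbedSync A F a b s) (hC0 : 0 ≤ C)
    (hC : ∀ t ∈ Set.Icc (-(b - a)) (b - a), ‖flow A t‖ ≤ C) :
    G.IsPerturbedConsensus (C * F) a b (fun k t => flow A (a - t) (s k t)) := by
  refine ⟨fun k => continuousOn_flow_sub_apply A a (h.continuousOn k), fun k t ht htS => ?_⟩
  obtain ⟨f, hf, hd⟩ := h.hasDerivAt k t ht htS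
  refine ⟨flow A (a - t) f, ?_, (hasDerivAt_flow_sub_apply a hd).congr_deriv ?_⟩
  · exact ((flow A (a - t)).le_opNorm f).trans (mul_le_mul (hC _ ⟨by linarith [ht.2],
      by linarith [ht.1, ht.2]⟩) hf (norm_nonneg _) hC0)
  · simp only [map_add, map_sum, ← map_sub]
    congr 1
    exact Finset.sum_congr rfl fun j _ =>
      ((flow A (a - t)).restrictScalars ℝ).map_smul (G.weight t k j) (s j t - s k t)

/-- There is a window length over which the disagreement is halved, up to the perturbation. -/
theorem exists_halving_window {G : TimeVaryingDigraph N}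
    (hpc : PiecewiseContinuousOnHalfLine G.laplacian) {T δ : ℝ} {r : Fin N}
    (hG : G.ConnectedWith T δ r) {A : E →L[ℂ] E}
    (hA : ∀ μ, Module.End.HasEigenvalue (A : Module.End ℂ E) μ → μ.re ≤ 0) :
    ∃ τ : ℝ, 0 < τ ∧ ∃ C : ℝ, 0 < C ∧ ∀ (F a D : ℝ) (s : Fin N → ℝ → E), 0 ≤ F → 0 ≤ a →
      (∀ j k, ‖s j a - s k a‖ ≤ D) → G.IsPerturbedSync A F a (a + τ) s →
      (∀ j k, ‖s j (a + τ) - s k (a + τ)‖ ≤ D / 2 + C * F) ∧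
      ∀ t ∈ Set.Icc a (a + τ), ∀ j k, ‖s j t - s k t‖ ≤ C * (D + F) := by
  set ρ : ℝ := 1 - G.gain T δ ^ N / 2 with hρ
  have hgain : G.gain T δ ^ N ≤ 1 :=
    pow_le_one₀ (G.gain_pos T hG.2.1).le (G.gain_le_one hG.1.le hG.2.1)
  have hgain0 : 0 < G.gain T δ ^ N := pow_pos (G.gain_pos T hG.2.1) N
  have hρ0 : 0 < ρ := by linarith
  have hρ1 : ρ < 1 := by linarith
  have hN : 0 < N := r.pos
  have hNT : 0 < N * T := mul_pos (Nat.cast_pos.2 hN) hG.1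
  -- First `ε` is chosen so that growth `e^{ε N T}` over one round of `N` windows is beaten by the
  -- contraction `ρ`. The constant `c` of the flow bound depends on `ε` and is absorbed afterwards
  -- by taking `m` rounds.
  obtain ⟨ε, hε, hερ⟩ : ∃ ε : ℝ, 0 < ε ∧ Real.exp (ε * (N * T)) * ρ < 1 := by
    have hcont : Tendsto (fun ε : ℝ => Real.exp (ε * (N * T)) * ρ) (𝓝[>] 0)
        (𝓝 (Real.exp (0 * (N * T)) * ρ)) :=
      (Continuous.tendsto (by fun_prop) 0).mono_left nhdsWithin_le_nhds
    have hlt : Real.exp (0 * (N * T)) * ρ < 1 := by simpa using hρ1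
    obtain ⟨ε, h1, h2⟩ := ((hcont.eventually_lt_const hlt).and self_mem_nhdsWithin).exists
    exact ⟨ε, h2, h1⟩
  obtain ⟨c, hc, hflow⟩ := exists_norm_flow_le_of_nonpos hA hε
  obtain ⟨m, hm1, hm⟩ : ∃ m : ℕ, 1 ≤ m ∧ c * (Real.exp (ε * (N * T)) * ρ) ^ m < 1 / 2 := by
    have hlim : Tendsto (fun m : ℕ => c * (Real.exp (ε * (N * T)) * ρ) ^ m) atTop (𝓝 (c * 0)) :=
      (tendsto_pow_atTop_nhds_zero_of_lt_one (by positivity) hερ).const_mul c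
    rw [mul_zero] at hlim
    obtain ⟨m, h1, h2⟩ := ((hlim.eventually_lt_const (by norm_num : (0 : ℝ) < 1 / 2)).and
      (eventually_ge_atTop 1)).exists
    exact ⟨m, h2, h1⟩
  set τ : ℝ := m * (N * T) with hτ
  have hτ0 : 0 < τ := mul_pos (Nat.cast_pos.2 hm1) hNT
  obtain ⟨C, hC0, hC⟩ := exists_norm_flow_le A τ
  refine ⟨τ, hτ0, C + C * (2 * C * τ), by positivity, fun F a D s hF ha hD h => ?_⟩
  have hz := h.isPerturbedConsensus hC0.le (by simpa using hC)
  have hz0 : ∀ j k, ‖flow A (a - a) (s j a) - flow A (a - a) (s k a)‖ ≤ D := fun j k => by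
    simpa [flow_zero] using hD j k
  have hback : ∀ t j k, s j t - s k t
      = flow A (t - a) (flow A (a - t) (s j t) - flow A (a - t) (s k t)) := fun t j k => by
    rw [← map_sub, ← flow_add_apply]
    simp [flow_zero]
  have hCFτ : 0 ≤ C * (2 * C * τ) * F := by positivity
  have hD0 : 0 ≤ D := (norm_nonneg _).trans (hD r r)
  constructor
  · intro j k
    have h1 := hz.contract_iterate hpc hG ha (by positivity) hz0 m j k
    rw [hback, add_sub_cancel_left]
    have h2 : ‖flow A τ‖ * ρ ^ m ≤ 1 / 2 := by
      refine le_trans (mul_le_mul_of_nonneg_right (hflow τ hτ0.le) (pow_pos hρ0 m).le) ?_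
      have h3 : Real.exp (ε * τ) = Real.exp (ε * (N * T)) ^ m := by
        rw [← Real.exp_nat_mul, hτ]
        ring_nf
      rw [h3, mul_assoc, ← mul_pow]
      exact hm.le
    have h4 : ‖flow A τ‖ ≤ C := hC τ ⟨by linarith, le_rfl⟩
    refine ((flow A τ).le_opNorm _).trans ?_
    calc _ ≤ ‖flow A τ‖ * (ρ ^ m * D + 2 * (C * F) * τ) :=
          mul_le_mul_of_nonneg_left h1 (norm_nonneg _)
      _ = ‖flow A τ‖ * ρ ^ m * D + ‖flow A τ‖ * (2 * (C * F) * τ) := by ring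
      _ ≤ 1 / 2 * D + C * (2 * (C * F) * τ) :=
          add_le_add (mul_le_mul_of_nonneg_right h2 hD0)
            (mul_le_mul_of_nonneg_right h4 (by positivity))
      _ ≤ D / 2 + (C + C * (2 * C * τ)) * F := by nlinarith
  · intro t ht j k
    have h1 := (hz.mono le_rfl ht.2).norm_sub_le hpc ha ht.1 hz0 j k
    rw [hback]
    have h4 : ‖flow A (t - a)‖ ≤ C := hC _ ⟨by linarith [ht.1], by linarith [ht.2]⟩
    refine ((flow A (t - a)).le_opNorm _).trans ?_
    have h5 : 2 * (C * F) * (t - a) ≤ 2 * (C * F) * τ :=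
      mul_le_mul_of_nonneg_left (by linarith [ht.2]) (by positivity)
    calc _ ≤ C * (D + 2 * (C * F) * τ) :=
          mul_le_mul h4 (h1.trans (by linarith)) (norm_nonneg _) hC0.le
      _ ≤ (C + C * (2 * C * τ)) * (D + F) := by
          have : 0 ≤ C * (2 * C * τ) * D := by positivity
          nlinarith

/-- Exponential decay of the disagreement under an exponentially decaying perturbation. -/
theorem exists_disagreement_le {G : TimeVaryingDigraph N}
    (hpc : PiecewiseContinuousOnHalfLine G.laplacian) {T δ : ℝ} {r : Fin N}
    (hG : G.ConnectedWith T δ r) {A : E →L[ℂ] E}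
    (hA : ∀ μ, Module.End.HasEigenvalue (A : Module.End ℂ E) μ → μ.re ≤ 0) {β : ℝ} (hβ : 0 < β) :
    ∃ α : ℝ, 0 < α ∧ α ≤ β ∧ ∃ c : ℝ, 0 < c ∧ ∀ (F t₀ D : ℝ) (s : Fin N → ℝ → E), 0 ≤ F → 0 ≤ t₀ →
      (∀ j k, ‖s j t₀ - s k t₀‖ ≤ D) →
      (∀ a, t₀ ≤ a → ∀ b, G.IsPerturbedSync A (F * Real.exp (-β * (a - t₀))) a b s) →
      ∀ t, t₀ ≤ t → ∀ j k, ‖s j t - s k t‖ ≤ c * (D + F) * Real.exp (-α * (t - t₀)) := by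
  obtain ⟨τ, hτ, C, hC, hwin⟩ := exists_halving_window hpc hG hA
  set α := min β (1 / (4 * τ)) with hα
  have hα0 : 0 < α := lt_min hβ (by positivity)
  have hαβ : α ≤ β := min_le_left _ _
  -- Halving beats the decay `3 / 4` demanded per window; the remaining quarter pays for the
  -- perturbation.
  have hατ : 3 / 4 ≤ Real.exp (-α * τ) := by
    have h1 : α * τ ≤ 1 / (4 * τ) * τ := mul_le_mul_of_nonneg_right (min_le_right _ _) hτ.le
    have h2 : 1 / (4 * τ) * τ = 1 / 4 := by field_simp
    linarith [Real.add_one_le_exp (-α * τ)]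
  refine ⟨α, hα0, hαβ, C * (4 * C + 2) * Real.exp (α * τ), by positivity,
    fun F t₀ D s hF ht₀ hD h t ht j k => ?_⟩
  have hD0 : 0 ≤ D := (norm_nonneg _).trans (hD r r)
  have hdec : ∀ i : ℕ, F * Real.exp (-β * (t₀ + i * τ - t₀)) ≤ F * Real.exp (-α * (i * τ)) := by
    intro i
    refine mul_le_mul_of_nonneg_left (Real.exp_le_exp.2 ?_) hF
    rw [add_sub_cancel_left]
    have : 0 ≤ i * τ := by positivity
    nlinarith
  -- The constant `4 C F` is preserved by the step: `(D + 4 C F) / 2 + C F ≤ (3 / 4) (D + 4 C F)`.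
  have key : ∀ i : ℕ, ∀ j k, ‖s j (t₀ + i * τ) - s k (t₀ + i * τ)‖
      ≤ (D + 4 * C * F) * Real.exp (-α * (i * τ)) := by
    intro i
    induction i with
    | zero =>
      intro j k
      have : 0 ≤ C * F := by positivity
      simp only [Nat.cast_zero, zero_mul, add_zero, mul_zero, Real.exp_zero, mul_one]
      linarith [hD j k]
    | succ i ih =>
      intro j k
      have hi : 0 ≤ i * τ := by positivity
      have h1 := (hwin _ (t₀ + i * τ) _ s (by positivity) (by linarith) ih
        (h _ (by linarith) _)).1 j k
      have hend : t₀ + (i + 1 : ℕ) * τ = t₀ + i * τ + τ := by push_cast; ring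
      rw [hend]
      refine h1.trans ?_
      set e := Real.exp (-α * (i * τ)) with he
      have he' : Real.exp (-α * ((i + 1 : ℕ) * τ)) = e * Real.exp (-α * τ) := by
        rw [he, ← Real.exp_add]
        push_cast
        ring_nf
      have hepos : 0 < e := Real.exp_pos _
      rw [he']
      have h2 := mul_le_mul_of_nonneg_left (hdec i) hC.le
      have h3 : (D + 4 * C * F) * (e * (3 / 4)) ≤ (D + 4 * C * F) * (e * Real.exp (-α * τ)) :=
        mul_le_mul_of_nonneg_left (mul_le_mul_of_nonneg_left hατ hepos.le) (by positivity)
      have h4 : 0 ≤ D * e := by positivity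
      linarith
  set i := ⌊(t - t₀) / τ⌋₊ with hi
  have hi1 : t₀ + i * τ ≤ t := by
    have := Nat.floor_le (div_nonneg (sub_nonneg.2 ht) hτ.le)
    rw [le_div_iff₀ hτ] at this
    linarith
  have hi2 : t ≤ t₀ + i * τ + τ := by
    have := (Nat.lt_floor_add_one ((t - t₀) / τ)).le
    rw [div_le_iff₀ hτ] at this
    linarith
  have hi0 : 0 ≤ i * τ := by positivity
  have h1 := (hwin _ (t₀ + i * τ) _ s (by positivity) (by linarith) (key i)
    (h _ (by linarith) _)).2 t ⟨hi1, hi2⟩ j k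
  have h2 : Real.exp (-α * (i * τ)) ≤ Real.exp (α * τ) * Real.exp (-α * (t - t₀)) := by
    rw [← Real.exp_add]
    refine Real.exp_le_exp.2 ?_
    nlinarith
  calc _ ≤ C * ((D + 4 * C * F) * Real.exp (-α * (i * τ)) + F * Real.exp (-α * (i * τ))) :=
        h1.trans (mul_le_mul_of_nonneg_left (add_le_add le_rfl (hdec i)) hC.le)
    _ = C * (D + (4 * C + 1) * F) * Real.exp (-α * (i * τ)) := by ring
    _ ≤ C * (D + (4 * C + 1) * F) * (Real.exp (α * τ) * Real.exp (-α * (t - t₀))) :=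
        mul_le_mul_of_nonneg_left h2 (by positivity)
    _ ≤ C * ((4 * C + 2) * (D + F)) * (Real.exp (α * τ) * Real.exp (-α * (t - t₀))) := by
        refine mul_le_mul_of_nonneg_right (mul_le_mul_of_nonneg_left ?_ hC.le) (by positivity)
        have : 0 ≤ C * D := by positivity
        nlinarith
    _ = _ := by ring

/-! ### The cascade: observer error, disagreement, controller state -/

/-- The closed loop in the coordinates `s = x̂ - η`, `η`, `e = x̂ - x`, with `M₁ = A + B K` and
`M₂ = A + H C`. -/
structure IsCascadeSolution (G : TimeVaryingDigraph N) (A M₁ M₂ : E →L[ℂ] E) (t₀ : ℝ)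
    (s η e : Fin N → ℝ → E) : Prop where
  continuousOn_s : ∀ k, ContinuousOn (s k) (Set.Ici t₀)
  continuousOn_η : ∀ k, ContinuousOn (η k) (Set.Ici t₀)
  continuousOn_e : ∀ k, ContinuousOn (e k) (Set.Ici t₀)
  deriv_s : ∀ k, ∀ t, t₀ < t → t ∉ G.switchTimes → HasDerivAt (s k)
    (A (s k t) + (∑ j, G.weight t k j • (s j t - s k t) + (M₂ - A) (e k t))) t
  deriv_η : ∀ k, ∀ t, t₀ < t → t ∉ G.switchTimes → HasDerivAt (η k)
    (M₁ (η k t) + ∑ j, G.weight t k j • (s k t - s j t)) t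
  deriv_e : ∀ k, ∀ t, t₀ < t → t ∉ G.switchTimes → HasDerivAt (e k) (M₂ (e k t)) t

/-- The cascade is solved from the bottom up: `e` decays by itself, it perturbs the synchronization
of `s`, and the disagreement of `s` drives the stable equation of `η`. Each stage gives up some
decay rate to keep the rates strictly ordered. For `s` only the initial differences are bounded by
`R`, since the common motion need not be small. -/
theorem exists_cascade_synchronization {G : TimeVaryingDigraph N}
    (hpc : PiecewiseContinuousOnHalfLine G.laplacian) {T δ : ℝ} {r : Fin N}
    (hG : G.ConnectedWith T δ r) {A M₁ M₂ : E →L[ℂ] E}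
    (hA : ∀ μ, Module.End.HasEigenvalue (A : Module.End ℂ E) μ → μ.re ≤ 0)
    (hM₁ : ∀ μ, Module.End.HasEigenvalue (M₁ : Module.End ℂ E) μ → μ.re < 0)
    (hM₂ : ∀ μ, Module.End.HasEigenvalue (M₂ : Module.End ℂ E) μ → μ.re < 0) :
    ∃ c : ℝ, 0 < c ∧ ∃ α : ℝ, 0 < α ∧ ∀ (t₀ R : ℝ) (s η e : Fin N → ℝ → E), 0 ≤ t₀ →
      G.IsCascadeSolution A M₁ M₂ t₀ s η e → (∀ j k, ‖s j t₀ - s k t₀‖ ≤ R) →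
      (∀ k, ‖η k t₀‖ ≤ R) → (∀ k, ‖e k t₀‖ ≤ R) →
      ∃ ξ : E, ∀ k, ∀ t, t₀ ≤ t →
        ‖s k t - flow A (t - t₀) ξ‖ ≤ c * R * Real.exp (-α * (t - t₀)) ∧
        ‖η k t‖ ≤ c * R * Real.exp (-α * (t - t₀)) ∧
        ‖e k t‖ ≤ c * R * Real.exp (-α * (t - t₀)) := by
  obtain ⟨γ₁, hγ₁, c₁, hc₁, hflow₁⟩ := exists_norm_flow_le_of_hurwitz hM₁
  obtain ⟨γ₂, hγ₂, c₂, hc₂, hflow₂⟩ := exists_norm_flow_le_of_hurwitz hM₂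
  set β := γ₂ / 2 with hβ
  have hβ0 : 0 < β := by positivity
  obtain ⟨α₁, hα₁, hα₁β, c₃, hc₃, hdis⟩ := exists_disagreement_le hpc hG hA hβ0
  obtain ⟨α₂, hα₂, hα₂₁, c₄, hc₄, hasym⟩ := exists_asymptotic_solution hA hα₁
  set α₃ := min α₂ (γ₁ / 2) with hα₃
  have hα₃0 : 0 < α₃ := lt_min hα₂ (by positivity)
  have hα₃₂ : α₃ ≤ α₂ := min_le_left _ _
  have hα₃γ : α₃ < γ₁ := (min_le_right _ _).trans_lt (by linarith)
  set κ := ‖M₂ - A‖ * c₂ with hκ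
  have hκ0 : 0 ≤ κ := by positivity
  set d := c₃ * (1 + κ) with hd
  have hd0 : 0 < d := by positivity
  have hrate := G.rate_nonneg
  refine ⟨(c₄ * (G.rate * d + κ) + d) + c₁ * (1 + G.rate * d / (γ₁ - α₃)) + c₂, ?_, α₃, hα₃0,
    fun t₀ R s η e ht₀ h hs0 hη0 he0 => ?_⟩
  · have : 0 < γ₁ - α₃ := sub_pos.2 hα₃γ
    positivity
  have hR : 0 ≤ R := (norm_nonneg _).trans (he0 r)
  have hZ : ∀ a b, (G.switchTimes ∩ Set.Ioo a b).Finite := finite_switchTimes hpc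
  have hexp : ∀ {α α' t : ℝ}, α' ≤ α → t₀ ≤ t →
      Real.exp (-α * (t - t₀)) ≤ Real.exp (-α' * (t - t₀)) := fun hα ht =>
    Real.exp_le_exp.2 (by nlinarith)
  have he : ∀ k, ∀ t, t₀ ≤ t → ‖e k t‖ ≤ c₂ * R * Real.exp (-β * (t - t₀)) := by
    intro k t ht
    have hsol : IsPerturbedSolution G.switchTimes M₂ 0 β t₀ (e k) :=
      ⟨h.continuousOn_e k, fun t ht htS => ⟨0, by simp, by simpa using h.deriv_e k t ht htS⟩⟩
    have h1 := hsol.norm_le_of_stable hZ (Commute.one_right M₂) le_rfl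
      (by linarith : β < γ₂) hc₂.le (by simpa using hflow₂) ht
    rw [zero_div, add_zero] at h1
    refine (show ‖e k t‖ ≤ _ from h1).trans ?_
    exact mul_le_mul_of_nonneg_right (mul_le_mul_of_nonneg_left (he0 k) hc₂.le)
      (Real.exp_pos _).le
  have hf : ∀ k, ∀ t, t₀ ≤ t → ‖(M₂ - A) (e k t)‖ ≤ κ * R * Real.exp (-β * (t - t₀)) := by
    intro k t ht
    calc _ ≤ ‖M₂ - A‖ * (c₂ * R * Real.exp (-β * (t - t₀))) :=
          ((M₂ - A).le_opNorm _).trans (mul_le_mul_of_nonneg_left (he k t ht) (norm_nonneg _))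
      _ = _ := by rw [hκ]; ring
  have hs : ∀ t, t₀ ≤ t → ∀ j k, ‖s j t - s k t‖ ≤ d * R * Real.exp (-α₁ * (t - t₀)) := by
    intro t ht j k
    have h1 := hdis (κ * R) t₀ R s (by positivity) ht₀ hs0 (fun a ha b =>
      ⟨fun k => (h.continuousOn_s k).mono fun t ht => ha.trans ht.1, fun k t ht htS =>
        ⟨(M₂ - A) (e k t), ?_, h.deriv_s k t (ha.trans_lt ht.1) htS⟩⟩) t ht j k
    · refine h1.trans (le_of_eq ?_)
      rw [hd]
      ring
    · refine (hf k t (ha.trans ht.1.le)).trans ?_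
      refine mul_le_mul_of_nonneg_left (Real.exp_le_exp.2 ?_) (by positivity)
      nlinarith [ht.1]
  have hcoup : ∀ k t, t₀ ≤ t → ∀ v : Fin N → E, (∀ j, ‖v j‖ = ‖s j t - s k t‖) →
      ‖∑ j, G.weight t k j • v j‖ ≤ G.rate * d * R * Real.exp (-α₁ * (t - t₀)) := by
    intro k t ht v hv
    refine (G.norm_sum_weight_smul_le (ht₀.trans ht) k
      (fun j => (hv j).trans_le (hs t ht j k))).trans (le_of_eq ?_)
    ring
  -- For a single node the coupling counts as a decaying input, so the asymptotic solution is taken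
  -- from the root; the other nodes follow it because the disagreement decays.
  obtain ⟨ξ, hξ⟩ := hasym G.switchTimes hZ ((G.rate * d + κ) * R) t₀ (s r) (by positivity)
    ⟨h.continuousOn_s r, fun t ht htS => ⟨_, by
      refine (norm_add_le _ _).trans (le_trans (add_le_add (hcoup r t ht.le _ fun j => rfl)
        ((hf r t ht.le).trans (mul_le_mul_of_nonneg_left (hexp hα₁β ht.le) (by positivity))))
        (le_of_eq ?_))
      ring, h.deriv_s r t ht htS⟩⟩
  refine ⟨ξ, fun k t ht => ?_⟩
  have hpos := Real.exp_pos (-α₃ * (t - t₀))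
  have hb₁ : ‖s k t - flow A (t - t₀) ξ‖
      ≤ (c₄ * (G.rate * d + κ) + d) * R * Real.exp (-α₃ * (t - t₀)) := by
    have h1 := norm_add_le (s k t - s r t) (s r t - flow A (t - t₀) ξ)
    rw [sub_add_sub_cancel] at h1
    have h2 := (hs t ht k r).trans (mul_le_mul_of_nonneg_left (hexp (hα₃₂.trans hα₂₁) ht)
      (by positivity))
    have h3 := (hξ t ht).trans (mul_le_mul_of_nonneg_left (hexp hα₃₂ ht) (by positivity))
    linarith
  have hb₂ : ‖η k t‖ ≤ c₁ * (1 + G.rate * d / (γ₁ - α₃)) * R * Real.exp (-α₃ * (t - t₀)) := by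
    have hsol : IsPerturbedSolution G.switchTimes M₁ (G.rate * d * R) α₃ t₀ (η k) :=
      ⟨h.continuousOn_η k, fun t ht htS => ⟨_,
        (hcoup k t ht.le _ fun j => norm_sub_rev _ _).trans
          (mul_le_mul_of_nonneg_left (hexp (hα₃₂.trans hα₂₁) ht.le) (by positivity)),
        h.deriv_η k t ht htS⟩⟩
    have h1 := hsol.norm_le_of_stable hZ (Commute.one_right M₁) (by positivity) hα₃γ hc₁.le
      (by simpa using hflow₁) ht
    refine (show ‖η k t‖ ≤ _ from h1).trans (mul_le_mul_of_nonneg_right ?_ hpos.le)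
    calc _ ≤ c₁ * (R + G.rate * d * R / (γ₁ - α₃)) :=
          mul_le_mul_of_nonneg_left (add_le_add (hη0 k) le_rfl) hc₁.le
      _ = _ := by ring
  have hb₃ : ‖e k t‖ ≤ c₂ * R * Real.exp (-α₃ * (t - t₀)) :=
    (he k t ht).trans (mul_le_mul_of_nonneg_left
      (hexp (hα₃₂.trans (hα₂₁.trans hα₁β)) ht) (by positivity))
  have hn₁ : 0 ≤ (c₄ * (G.rate * d + κ) + d) * R * Real.exp (-α₃ * (t - t₀)) := by positivity
  have hn₂ : 0 ≤ c₁ * (1 + G.rate * d / (γ₁ - α₃)) * R * Real.exp (-α₃ * (t - t₀)) :=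
    (norm_nonneg _).trans hb₂
  have hn₃ : 0 ≤ c₂ * R * Real.exp (-α₃ * (t - t₀)) := by positivity
  rw [add_mul, add_mul, add_mul, add_mul]
  exact ⟨by linarith, by linarith, by linarith⟩

end TimeVaryingDigraph

/-! ### Passage between real and complex vectors, and between norms -/

section Complexification

variable {n m : ℕ}

/-- The inclusion `ℝⁿ → ℂⁿ`. -/
noncomputable def complexify (n : ℕ) : (Fin n → ℝ) →L[ℝ] (Fin n → ℂ) :=
  ContinuousLinearMap.pi fun i => Complex.ofRealCLM.comp (ContinuousLinearMap.proj i)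

/-- The componentwise real part `ℂⁿ → ℝⁿ`. -/
noncomputable def reVec (n : ℕ) : (Fin n → ℂ) →L[ℝ] (Fin n → ℝ) :=
  ContinuousLinearMap.pi fun i => Complex.reCLM.comp (ContinuousLinearMap.proj i)

@[simp] theorem complexify_apply (v : Fin n → ℝ) (i : Fin n) : complexify n v i = v i := rfl

@[simp] theorem reVec_apply (w : Fin n → ℂ) (i : Fin n) : reVec n w i = (w i).re := rfl

@[simp] theorem reVec_complexify (v : Fin n → ℝ) : reVec n (complexify n v) = v := by
  ext i
  simp

theorem norm_complexify (v : Fin n → ℝ) : ‖complexify n v‖ = ‖v‖ := by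
  simp only [Pi.norm_def, complexify_apply, Complex.nnnorm_real]

theorem norm_reVec_le (w : Fin n → ℂ) : ‖reVec n w‖ ≤ ‖w‖ :=
  (pi_norm_le_iff_of_nonneg (norm_nonneg _)).2 fun i =>
    (Complex.abs_re_le_norm _).trans (norm_le_pi_norm w i)

/-- The operator on `ℂⁿ` of a real matrix. -/
noncomputable def complexOperator (M : Matrix (Fin n) (Fin n) ℝ) :
    (Fin n → ℂ) →L[ℂ] (Fin n → ℂ) :=
  LinearMap.toContinuousLinearMap (Matrix.toLin' (M.map (algebraMap ℝ ℂ)))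

theorem complexOperator_apply (M : Matrix (Fin n) (Fin n) ℝ) (w : Fin n → ℂ) (i : Fin n) :
    complexOperator M w i = ∑ j, (M i j : ℂ) * w j := rfl

theorem complexOperator_complexify (M : Matrix (Fin n) (Fin n) ℝ) (v : Fin n → ℝ) :
    complexOperator M (complexify n v) = complexify n (M *ᵥ v) := by
  ext i
  simp [complexOperator_apply, Matrix.mulVec, dotProduct]

theorem reVec_complexOperator (M : Matrix (Fin n) (Fin n) ℝ) (w : Fin n → ℂ) :
    reVec n (complexOperator M w) = M *ᵥ reVec n w := by
  ext i
  simp [complexOperator_apply, Matrix.mulVec, dotProduct]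

theorem mem_spectrum_of_hasEigenvalue_complexOperator {M : Matrix (Fin n) (Fin n) ℝ} {μ : ℂ}
    (h : Module.End.HasEigenvalue (complexOperator M : Module.End ℂ (Fin n → ℂ)) μ) :
    μ ∈ spectrum ℂ (M.map (algebraMap ℝ ℂ)) := by
  rw [← Matrix.spectrum_toLin']
  exact Module.End.HasEigenvalue.mem_spectrum h

theorem norm_le_euclNorm (v : Fin n → ℝ) : ‖v‖ ≤ euclNorm v :=
  (pi_norm_le_iff_of_nonneg (norm_nonneg _)).2 fun i => PiLp.norm_apply_le (WithLp.toLp 2 v) i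

theorem exists_euclNorm_le (L : (Fin n → ℝ) →ₗ[ℝ] (Fin m → ℝ)) :
    ∃ C : ℝ, 0 < C ∧ ∀ v, euclNorm (L v) ≤ C * ‖v‖ := by
  set T := LinearMap.toContinuousLinearMap
    ((WithLp.linearEquiv 2 ℝ (Fin m → ℝ)).symm.toLinearMap ∘ₗ L) with hT
  refine ⟨‖T‖ + 1, by positivity, fun v => (T.le_opNorm v).trans ?_⟩
  exact mul_le_mul_of_nonneg_right (by linarith) (norm_nonneg _)

end Complexification

/-! ### The closed loop as a cascade, and the main theorem -/

/-- The input `B K η_k` enters `x`, `x̂` and `η` alike, so it cancels in `x̂ - η` and `x̂ - x`. The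
coupling of the controller depends only on differences of `x̂ - η`, and `M₂ - A` is `H C`. -/
theorem IsClosedLoopSolution.isCascadeSolution {N n m p : ℕ} {A : Matrix (Fin n) (Fin n) ℝ}
    {B : Matrix (Fin n) (Fin m) ℝ} {C : Matrix (Fin p) (Fin n) ℝ} {K : Matrix (Fin m) (Fin n) ℝ}
    {H : Matrix (Fin n) (Fin p) ℝ} {G : TimeVaryingDigraph N} {t₀ : ℝ}
    {x η xhat : Fin N → ℝ → Fin n → ℝ} (h : IsClosedLoopSolution A B C K H G t₀ x η xhat)
    (ht₀ : 0 ≤ t₀) :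
    G.IsCascadeSolution (complexOperator A) (complexOperator (A + B * K))
      (complexOperator (A + H * C)) t₀ (fun k t => complexify n (xhat k t - η k t))
      (fun k t => complexify n (η k t)) (fun k t => complexify n (xhat k t - x k t)) := by
  have hcont : ∀ t, t₀ < t → t ∉ G.switchTimes → ContinuousAt G.laplacian t := by
    intro t ht hS
    by_contra hc
    exact hS ⟨ht₀.trans_lt ht, hc⟩
  refine ⟨fun k => (complexify n).continuous.comp_continuousOn
      ((h.continuousOn_xhat k).sub (h.continuousOn_η k)),
    fun k => (complexify n).continuous.comp_continuousOn (h.continuousOn_η k),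
    fun k => (complexify n).continuous.comp_continuousOn
      ((h.continuousOn_xhat k).sub (h.continuousOn_x k)),
    fun k t ht hS => ?_, fun k t ht hS => ?_, fun k t ht hS => ?_⟩
  · have hd := (h.deriv_xhat k t ht (hcont t ht hS)).sub (h.deriv_η k t ht (hcont t ht hS))
    refine ((complexify n).hasFDerivAt.comp_hasDerivAt t hd).congr_deriv ?_
    simp only [sub_apply, complexOperator_complexify, ← map_sub, ← map_smul, ← map_sum, ← map_add]
    congr 1
    have hsum : ∑ j, G.weight t k j • (η j t - η k t + xhat k t - xhat j t)
        = - ∑ j, G.weight t k j • (xhat j t - η j t - (xhat k t - η k t)) := by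
      rw [← Finset.sum_neg_distrib]
      exact Finset.sum_congr rfl fun j _ => by rw [← smul_neg]; congr 1; abel
    rw [hsum]
    simp only [Matrix.add_mulVec, Matrix.mulVec_sub, ← Matrix.mulVec_mulVec]
    abel
  · refine ((complexify n).hasFDerivAt.comp_hasDerivAt t
      (h.deriv_η k t ht (hcont t ht hS))).congr_deriv ?_
    simp only [complexOperator_complexify, ← map_sub, ← map_smul, ← map_sum, ← map_add]
    congr 2
    exact Finset.sum_congr rfl fun j _ => by congr 1; abel
  · have hd := (h.deriv_xhat k t ht (hcont t ht hS)).sub (h.deriv_x k t ht (hcont t ht hS))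
    refine ((complexify n).hasFDerivAt.comp_hasDerivAt t hd).congr_deriv ?_
    rw [complexOperator_complexify]
    congr 1
    simp only [Matrix.add_mulVec, Matrix.mulVec_sub, ← Matrix.mulVec_mulVec]
    abel

theorem mainTheorem1 {N n m p : ℕ} (A : Matrix (Fin n) (Fin n) ℝ)
    (B : Matrix (Fin n) (Fin m) ℝ) (C : Matrix (Fin p) (Fin n) ℝ)
    (hstab : IsStabilizable A B) (hdet : IsDetectable A C)
    (hA : SpectrumInClosedLeftHalfPlane A)
    (G : TimeVaryingDigraph N) (hG : G.UniformlyConnected)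
    (hLpc : PiecewiseContinuousOnHalfLine G.laplacian)
    (hLbd : BoundedOnHalfLine G.laplacian)
    (K : Matrix (Fin m) (Fin n) ℝ) (H : Matrix (Fin n) (Fin p) ℝ)
    (hK : IsHurwitz (A + B * K)) (hH : IsHurwitz (A + H * C)) :
    ExponentiallySynchronizes N A B C K H G := by
  obtain ⟨T, hT, δ, hδ, r, hpath⟩ := hG
  obtain ⟨c, hc, α, hα, hsync⟩ := TimeVaryingDigraph.exists_cascade_synchronization hLpc
    (⟨hT, hδ, hpath⟩ : G.ConnectedWith T δ r)
    (fun μ hμ => hA μ (mem_spectrum_of_hasEigenvalue_complexOperator hμ))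
    (fun μ hμ => hK μ (mem_spectrum_of_hasEigenvalue_complexOperator hμ))
    (fun μ hμ => hH μ (mem_spectrum_of_hasEigenvalue_complexOperator hμ))
  obtain ⟨C₁, hC₁, hid⟩ := exists_euclNorm_le (LinearMap.id : (Fin n → ℝ) →ₗ[ℝ] (Fin n → ℝ))
  obtain ⟨C₂, hC₂, hKv⟩ := exists_euclNorm_le (Matrix.toLin' K)
  -- `C₁` and `C₂` pass from the sup norm to the Euclidean norm of `x_k - x₀` and of `K η_k`; the
  -- `3` comes from `x - x₀ = (s - x₀) + η - e`, and `2 N² + 2` from bounding `R` by the initial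
  -- deviation.
  refine ⟨(3 * C₁ + C₂) * c * (2 * N * N + 2), by positivity, α, hα,
    fun t₀ ht₀ x η xhat h => ?_⟩
  set R : ℝ := ∑ j, ∑ k, ‖(xhat j t₀ - η j t₀) - (xhat k t₀ - η k t₀)‖
    + (∑ k, ‖η k t₀‖ + ∑ k, ‖xhat k t₀ - x k t₀‖) with hR
  have hR₁ : ∀ j k, ‖(xhat j t₀ - η j t₀) - (xhat k t₀ - η k t₀)‖ ≤ R := fun j k => by
    have h1 := Finset.single_le_sum (f := fun k =>
      ‖(xhat j t₀ - η j t₀) - (xhat k t₀ - η k t₀)‖) (fun _ _ => norm_nonneg _)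
      (Finset.mem_univ k)
    have h2 := Finset.single_le_sum (f := fun j => ∑ k,
      ‖(xhat j t₀ - η j t₀) - (xhat k t₀ - η k t₀)‖)
      (fun _ _ => Finset.sum_nonneg fun _ _ => norm_nonneg _) (Finset.mem_univ j)
    have h3 : 0 ≤ ∑ k, ‖η k t₀‖ + ∑ k, ‖xhat k t₀ - x k t₀‖ := by positivity
    linarith
  have hpos₁ : 0 ≤ ∑ j, ∑ k, ‖(xhat j t₀ - η j t₀) - (xhat k t₀ - η k t₀)‖ := by positivity
  have hR₂ : ∀ k, ‖η k t₀‖ ≤ R := fun k => by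
    have h1 := Finset.single_le_sum (f := fun k => ‖η k t₀‖) (fun _ _ => norm_nonneg _)
      (Finset.mem_univ k)
    have h3 : 0 ≤ ∑ k, ‖xhat k t₀ - x k t₀‖ := by positivity
    linarith
  have hR₃ : ∀ k, ‖xhat k t₀ - x k t₀‖ ≤ R := fun k => by
    have h1 := Finset.single_le_sum (f := fun k => ‖xhat k t₀ - x k t₀‖)
      (fun _ _ => norm_nonneg _) (Finset.mem_univ k)
    have h3 : 0 ≤ ∑ k, ‖η k t₀‖ := by positivity
    linarith
  obtain ⟨ξ, hξ⟩ := hsync t₀ R _ _ _ ht₀ (h.isCascadeSolution ht₀)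
    (fun j k => by rw [← map_sub, norm_complexify]; exact hR₁ j k)
    (fun k => by rw [norm_complexify]; exact hR₂ k)
    (fun k => by rw [norm_complexify]; exact hR₃ k)
  -- The limit `ξ` may be non-real. As `A` is real, the real part of the complex solution is again a
  -- solution, and taking real parts does not increase the distance to the real vector `s_k`.
  set x₀ : ℝ → Fin n → ℝ := fun t => reVec n (flow (complexOperator A) (t - t₀) ξ) with hx₀
  refine ⟨x₀, fun t => ?_, fun k t ht => ?_⟩
  · have h1 := (hasDerivAt_flow_apply (complexOperator A) ξ (t - t₀)).comp_sub_const t t₀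
    refine ((reVec n).hasFDerivAt.comp_hasDerivAt t h1).congr_deriv ?_
    exact reVec_complexOperator A _
  set V : ℝ := ∑ j, (euclNorm (x j t₀ - x₀ t₀) + euclNorm (η j t₀)
    + euclNorm (xhat j t₀ - x₀ t₀)) with hV
  have hterm : ∀ j, 0 ≤ euclNorm (x j t₀ - x₀ t₀) + euclNorm (η j t₀)
      + euclNorm (xhat j t₀ - x₀ t₀) := fun j =>
    add_nonneg (add_nonneg (norm_nonneg _) (norm_nonneg _)) (norm_nonneg _)
  have hsingle : ∀ j, ‖η j t₀‖ + ‖xhat j t₀ - x₀ t₀‖ ≤ V := fun j => by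
    have h1 := Finset.single_le_sum (fun j _ => hterm j) (Finset.mem_univ j)
    have h2 : 0 ≤ euclNorm (x j t₀ - x₀ t₀) := norm_nonneg _
    linarith [norm_le_euclNorm (η j t₀), norm_le_euclNorm (xhat j t₀ - x₀ t₀)]
  -- `R` is built from differences in which `x₀ t₀` cancels, so it could be fixed before `x₀` was
  -- known and is still bounded by deviations from `x₀`.
  have hRV : R ≤ (2 * N * N + 2) * V := by
    have h1 : ∑ j, ∑ k, ‖(xhat j t₀ - η j t₀) - (xhat k t₀ - η k t₀)‖ ≤ 2 * N * N * V := by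
      calc _ ≤ ∑ _j : Fin N, ∑ _k : Fin N, 2 * V := by
            refine Finset.sum_le_sum fun j _ => Finset.sum_le_sum fun k _ => ?_
            have h2 : (xhat j t₀ - η j t₀) - (xhat k t₀ - η k t₀)
                = ((xhat j t₀ - x₀ t₀) - η j t₀) - ((xhat k t₀ - x₀ t₀) - η k t₀) := by abel
            rw [h2]
            have h3 := norm_sub_le ((xhat j t₀ - x₀ t₀) - η j t₀) ((xhat k t₀ - x₀ t₀) - η k t₀)
            linarith [norm_sub_le (xhat j t₀ - x₀ t₀) (η j t₀),
              norm_sub_le (xhat k t₀ - x₀ t₀) (η k t₀), hsingle j, hsingle k]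
        _ = _ := by
            simp only [Finset.sum_const, Finset.card_univ, Fintype.card_fin, nsmul_eq_mul]
            ring
    have h4 : ∑ k, ‖η k t₀‖ + ∑ k, ‖xhat k t₀ - x k t₀‖ ≤ 2 * V := by
      rw [← Finset.sum_add_distrib, hV, Finset.mul_sum]
      refine Finset.sum_le_sum fun j _ => ?_
      have h5 := norm_sub_le (xhat j t₀ - x₀ t₀) (x j t₀ - x₀ t₀)
      rw [sub_sub_sub_cancel_right] at h5
      linarith [norm_le_euclNorm (η j t₀), norm_le_euclNorm (xhat j t₀ - x₀ t₀),
        norm_le_euclNorm (x j t₀ - x₀ t₀), hterm j, norm_nonneg (η j t₀)]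
    linarith
  obtain ⟨hs, hη, he⟩ := hξ k t ht
  rw [norm_complexify] at hη he
  have hs' : ‖xhat k t - η k t - x₀ t‖ ≤ c * R * Real.exp (-α * (t - t₀)) := by
    refine le_trans ?_ hs
    refine le_trans (le_of_eq ?_) (norm_reVec_le _)
    rw [map_sub, reVec_complexify]
  have hexp := Real.exp_pos (-α * (t - t₀))
  have hbound : c * R * Real.exp (-α * (t - t₀))
      ≤ c * ((2 * N * N + 2) * V) * Real.exp (-α * (t - t₀)) :=
    mul_le_mul_of_nonneg_right (mul_le_mul_of_nonneg_left hRV hc.le) hexp.le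
  set b := c * ((2 * N * N + 2) * V) * Real.exp (-α * (t - t₀)) with hb
  have hb0 : 0 ≤ b := (norm_nonneg _).trans (hη.trans hbound)
  have hgoal : (3 * C₁ + C₂) * c * (2 * N * N + 2) * Real.exp (-α * (t - t₀)) * V
      = 3 * C₁ * b + C₂ * b := by
    rw [hb]
    ring
  rw [hgoal]
  constructor
  · have h1 : x k t - x₀ t
        = (xhat k t - η k t - x₀ t) + η k t - (xhat k t - x k t) := by abel
    have h2 : ‖x k t - x₀ t‖ ≤ 3 * b := by
      rw [h1]
      refine (norm_sub_le _ _).trans ?_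
      have := norm_add_le (xhat k t - η k t - x₀ t) (η k t)
      linarith
    have h3 := hid (x k t - x₀ t)
    rw [LinearMap.id_apply] at h3
    nlinarith [mul_nonneg hC₂.le hb0]
  · have h3 := hKv (η k t)
    rw [Matrix.toLin'_apply] at h3
    nlinarith [mul_nonneg hC₁.le hb0]
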